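/- Consider $n\ge 1$ bosonic modes, with mode $i$ prepared in a squeezed vacuum state with squeezing parameter $s_i\in\mathbb R$, so that (in units where the vacuum has covariance matrix $I$) the initial covariance matrix is $\sigma_0=Z\oplus Z^{-1}$ with $Z=\mathrm{diag}(e^{2s_1},\dots,e^{2s_n})$. For a unitary $U\in U(n)$ let $$\eta(U)=\begin{pmatrix}\operatorname{Re}U&\operatorname{Im}U\\-\operatorname{Im}U&\operatorname{Re}U\end{pmatrix}$$ be the phase-space action of the corresponding passive Gaussian (linear optical) unitary, and let $\sigma(U)$ be the $2k\times 2k$ submatrix of $\eta(U)\sigma_0\eta(U)^T$ belonging to the positions and momenta of the first $k$ modes, $0\le k\le n$. Let $S_2(U)=\frac12\log\det\sigma(U)$, the Rényi-2 entropy of the reduced Gaussian state on these $k$ modes, let $\mathbb E_U$ denote the expectation over $U(n)$ with respect to the Haar probability measure, and put $r=k/n$ and $s_{\max}=\max_i|s_i|$. Then $S_2$ is integrable, and, with all constants independent of $n$, $k$ and $(s_i)$: 1. (Fixed squeezings.) There is an absolute constant $C$ such that for every fixed real sequence $(s_i)_{i\ge1}$ and all sufficiently large $n$ (depending on the sequence),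 for all $0\le k\le n$, $$\Bigl|\mathbb E_U S_2(U)-2r(1-r)\sum_{i=1}^n s_i^2\Bigr|\le C\,r\,n\,s_{\max}^4 .$$ 2. (Squeezings that may depend on $n$.) For every $c>0$ there is a $C$ (depending only on $c$) such that the same bound holds for all $n\ge1$, $0\le k\le n$ and $(s_1,\dots,s_n)\in\mathbb R^n$ with $n\,s_{\max}^2\ge c$. Without any restriction on the squeezings, for an absolute constant $C$ and all $n\ge1$, $0\le k\le n$, $(s_1,\dots,s_n)\in\mathbb R^n$, $$\Bigl|\mathbb E_U S_2(U)-2r(1-r)\sum_{i=1}^n s_i^2\Bigr|\le C\,\bigl(r\,n\,s_{\max}^4+r\,s_{\max}^2\bigr).$$ 3. (Constant boson number.) For every $K>0$ there is a $C$ (depending only on $K$) such that for all $n\ge1$, $0\le k\le n$ and $(s_1,\dots,s_n)\in\mathbb R^n$ with $|s_i|\le K/\sqrt n$ for every $i$, the expected total boson number $N=\sum_{i=1}^n\sinh^2(s_i)$ satisfies $N\le C$, and $$\bigl|\mathbb E_U S_2(U)-2r(1-r)N\bigr|\le C\,\frac{r}{n};$$ that is, the Page curve is asymptotically $2r(1-r)N$.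 -/

import Mathlib

open MeasureTheory Filter

noncomputable section

namespace LinearOptics

/-! ### The Haar probability measure on the unitary group -/

instance instCompactSpaceUnitaryGroup (n : ℕ) :
    CompactSpace (Matrix.unitaryGroup (Fin n) ℂ) := by
  suffices h : IsCompact (Matrix.unitaryGroup (Fin n) ℂ : Set (Matrix (Fin n) (Fin n) ℂ)) from
    isCompact_iff_compactSpace.mp h
  have hK : IsCompact (Set.pi Set.univ fun _ : Fin n => Set.pi Set.univ fun _ : Fin n =>
      Metric.closedBall (0 : ℂ) 1) :=
    isCompact_univ_pi fun _ => isCompact_univ_pi fun _ => isCompact_closedBall _ _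
  refine hK.of_isClosed_subset ?_ ?_
  · have h : (Matrix.unitaryGroup (Fin n) ℂ : Set (Matrix (Fin n) (Fin n) ℂ)) =
        {A | A * star A = 1} := by
      ext A
      exact Matrix.mem_unitaryGroup_iff
    rw [h]
    exact isClosed_eq (by fun_prop) continuous_const
  · intro A hA i _ j _
    simpa using entry_norm_bound_of_unitary hA i j

instance instMeasurableSpaceUnitaryGroup (n : ℕ) :
    MeasurableSpace (Matrix.unitaryGroup (Fin n) ℂ) :=
  borel _

instance instBorelSpaceUnitaryGroup (n : ℕ) :
    BorelSpace (Matrix.unitaryGroup (Fin n) ℂ) :=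
  ⟨rfl⟩

/-- The Haar measure on `U(n)`, normalized to have total mass one. -/
def haarU (n : ℕ) : Measure (Matrix.unitaryGroup (Fin n) ℂ) :=
  Measure.haarMeasure ⊤

instance instIsProbabilityMeasureHaarU (n : ℕ) : IsProbabilityMeasure (haarU n) :=
  ⟨by
    have h := Measure.haarMeasure_self
      (K₀ := (⊤ : TopologicalSpace.PositiveCompacts (Matrix.unitaryGroup (Fin n) ℂ)))
    simpa [haarU] using h⟩

instance instIsHaarMeasureHaarU (n : ℕ) : (haarU n).IsHaarMeasure := by
  unfold haarU
  infer_instance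

/-! ### Covariance matrices

Phase space of `n` modes is indexed by `Fin n ⊕ Fin n`: positions first, then momenta. Covariance
matrices are normalized so that the vacuum has covariance matrix `1`. -/

/-- `Z ⊕ Z⁻¹` with `Z = diag (e^{2 s₁}, …, e^{2 sₙ})`: the covariance matrix of the product of the
squeezed vacuum states with squeezing parameters `s₁, …, sₙ`. -/
def initialCov {n : ℕ} (s : Fin n → ℝ) : Matrix (Fin n ⊕ Fin n) (Fin n ⊕ Fin n) ℝ :=
  Matrix.fromBlocks (Matrix.diagonal fun i => Real.exp (2 * s i)) 0
    0 (Matrix.diagonal fun i => Real.exp (-(2 * s i)))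

/-- The isomorphism from `U(n)` to the orthogonal symplectic `2n × 2n` matrices, which gives the
action on phase space of the passive Gaussian unitary (linear optical network) of `U`. -/
def passive {n : ℕ} (U : Matrix (Fin n) (Fin n) ℂ) :
    Matrix (Fin n ⊕ Fin n) (Fin n ⊕ Fin n) ℝ :=
  Matrix.fromBlocks (U.map Complex.re) (U.map Complex.im)
    (-(U.map Complex.im)) (U.map Complex.re)

/-- Covariance matrix of the `n`-mode pure Gaussian state obtained by applying the linear optical
network of `U` to the product of squeezed vacuum states. -/
def evolvedCov {n : ℕ} (s : Fin n → ℝ) (U : Matrix (Fin n) (Fin n) ℂ) :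
    Matrix (Fin n ⊕ Fin n) (Fin n ⊕ Fin n) ℝ :=
  passive U * initialCov s * (passive U).transpose

/-- The `k × n` matrix `(1 0)`, which selects the first `k` of the `n` modes. -/
def selectModes (k n : ℕ) : Matrix (Fin k) (Fin n) ℝ :=
  Matrix.of fun i j => if (i : ℕ) = (j : ℕ) then 1 else 0

/-- Covariance matrix of the reduced state on the first `k` modes. -/
def reducedCov (k : ℕ) {n : ℕ} (s : Fin n → ℝ) (U : Matrix (Fin n) (Fin n) ℂ) :
    Matrix (Fin k ⊕ Fin k) (Fin k ⊕ Fin k) ℝ :=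
  Matrix.fromBlocks (selectModes k n) 0 0 (selectModes k n) * evolvedCov s U *
    (Matrix.fromBlocks (selectModes k n) 0 0 (selectModes k n)).transpose

/-- The Rényi-2 entropy `½ log det σ` of a Gaussian state with covariance matrix `σ`. -/
def renyi2 {ι : Type*} [Fintype ι] [DecidableEq ι] (σ : Matrix ι ι ℝ) : ℝ :=
  1 / 2 * Real.log σ.det

/-- The Rényi-2 entanglement entropy `S₂(U)` of the first `k` of the `n` modes. -/
def S₂ (k : ℕ) {n : ℕ} (s : Fin n → ℝ) (U : Matrix.unitaryGroup (Fin n) ℂ) : ℝ :=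
  renyi2 (reducedCov k s (U : Matrix (Fin n) (Fin n) ℂ))

/-- The Rényi-2 Page curve: the Haar average of `S₂(U)`. -/
def pageCurve (k : ℕ) {n : ℕ} (s : Fin n → ℝ) : ℝ :=
  ∫ U, S₂ k s U ∂(haarU n)

/-- The largest squeezing strength `max_i |s_i|`. -/
def sMax {n : ℕ} (s : Fin n → ℝ) : ℝ :=
  ⨆ i, |s i|

/-- The expected total number of bosons. -/
def totalBosons {n : ℕ} (s : Fin n → ℝ) : ℝ :=
  ∑ i, Real.sinh (s i) ^ 2

/-- The fraction `r = k / n` of the modes that lie in the subsystem. -/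
def ratio (k n : ℕ) : ℝ :=
  (k : ℝ) / (n : ℝ)

end LinearOptics

end

noncomputable section

namespace LinearOptics

/-! The reduced covariance matrix is `V diag(e^{2s}, e^{-2s}) Vᵀ` with `V Vᵀ = 1`
(`frame_mul_transpose`). Writing `e^{±2s} = 1 + (cosh 2s - 1) ± sinh 2s` turns it into `1 + C + D`,
with `C` of second and `D` of first order in the squeezing. The symplectic form commutes with `C`
and anticommutes with `D`, so every trace of odd degree in `D` vanishes, and `log det = tr C - tr D²
/ 2` up to fourth order (`abs_log_det_sub_le_of_anticommute`, `abs_S₂_sub_le`).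

The Haar averages of these two traces need only moments of degree two and four. They give `E tr C =
2r ∑ (cosh 2sᵢ - 1)` and `E tr D² = 2r (k+1)/(n+1) ∑ sinh² 2sᵢ`, hence `E S₂ ≈ 2r (1 - (k+1)/(n+1))
∑ sᵢ²`. Replacing `(k+1)/(n+1)` by `r` costs `O(r sMax²)`. When `sMax` is not small, the trivial
bound `|S₂| ≤ 2k sMax` is already `O(k sMax⁴)`. Together this is `abs_pageCurve_sub_sum_sq_le`, from
which every regime of the theorem follows. -/

/-! ### Moments of the Haar measure on the unitary group -/

/-- The rotation with cosine `3/5`, sine `4/5` and phase `ω` in the plane of coordinates `a`, `b`. -/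
def planeRotation {n : ℕ} (a b : Fin n) (ω : ℂ) : Matrix (Fin n) (Fin n) ℂ :=
  Matrix.of fun i j =>
    if i = a then (if j = a then 3 / 5 else if j = b then 4 / 5 * ω else 0)
    else if i = b then (if j = a then -(4 / 5 * star ω) else if j = b then 3 / 5 else 0)
    else if j = i then 1 else 0

lemma planeRotation_mul_apply {n m : ℕ} {a b : Fin n} (hab : a ≠ b) (ω : ℂ)
    (M : Matrix (Fin n) (Fin m) ℂ) (i : Fin n) (j : Fin m) :
    (planeRotation a b ω * M) i j =
      if i = a then 3 / 5 * M a j + 4 / 5 * ω * M b j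
      else if i = b then -(4 / 5 * star ω) * M a j + 3 / 5 * M b j else M i j := by
  rw [Matrix.mul_apply]
  by_cases hia : i = a
  · subst hia
    rw [Finset.sum_eq_add i b hab]
    · simp [planeRotation, hab.symm]
    · intro c _ hc
      simp [planeRotation, hc.1, hc.2]
    · simp
    · simp
  by_cases hib : i = b
  · subst hib
    rw [Finset.sum_eq_add a i hab]
    · simp [planeRotation, hia]
    · intro c _ hc
      simp [planeRotation, hc.1, hc.2, hia]
    · simp
    · simp
  · rw [Finset.sum_eq_single i]
    · simp [planeRotation, hia, hib]
    · intro c _ hc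
      simp [planeRotation, hia, hib, hc]
    · simp

lemma planeRotation_mem {n : ℕ} {a b : Fin n} (hab : a ≠ b) {ω : ℂ} (hω : ω * star ω = 1) :
    planeRotation a b ω ∈ Matrix.unitaryGroup (Fin n) ℂ := by
  have hω' : ω * (starRingEnd ℂ) ω = 1 := hω
  rw [Matrix.mem_unitaryGroup_iff]
  ext i j
  rw [planeRotation_mul_apply hab]
  by_cases hia : i = a
  · by_cases hja : j = a
    · subst hia hja
      simp [planeRotation, hab.symm]
      linear_combination (16 / 25) * hω'
    · by_cases hjb : j = b
      · subst hia hjb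
        simp [planeRotation, hab.symm, hab]
        ring
      · subst hia
        simp [planeRotation, hja, hjb, Ne.symm hja, Ne.symm hjb]
  · by_cases hib : i = b
    · by_cases hja : j = a
      · subst hib hja
        simp [planeRotation, hab.symm]
        ring
      · by_cases hjb : j = b
        · subst hib hjb
          simp [planeRotation, hab.symm]
          linear_combination (16 / 25) * hω'
        · subst hib
          simp [planeRotation, hja, hjb, Ne.symm hja, Ne.symm hjb, hab.symm]
    · by_cases hja : j = a
      · subst hja
        simp [planeRotation, hia, hib]
      · by_cases hjb : j = b
        · subst hjb
          simp [planeRotation, hia, hib, hab.symm]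
        · by_cases hij : i = j
          · subst hij
            simp [planeRotation, hia, hib]
          · simp [planeRotation, hia, hib, hja, hjb, hij]

/-- The diagonal matrix with entry `I` at `i` and `1` elsewhere. -/
def phaseShift {n : ℕ} (i : Fin n) : Matrix (Fin n) (Fin n) ℂ :=
  Matrix.diagonal fun j => if j = i then Complex.I else 1

lemma phaseShift_mem {n : ℕ} (i : Fin n) :
    phaseShift i ∈ Matrix.unitaryGroup (Fin n) ℂ := by
  rw [Matrix.mem_unitaryGroup_iff, Matrix.star_eq_conjTranspose, phaseShift,
    Matrix.diagonal_conjTranspose, Matrix.diagonal_mul_diagonal, ← Matrix.diagonal_one]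
  congr 1
  ext j
  by_cases h : j = i <;> simp [h]

/-- The matrix entries of a unitary. -/
def entry {n : ℕ} (U : Matrix.unitaryGroup (Fin n) ℂ) (i j : Fin n) : ℂ :=
  (U : Matrix (Fin n) (Fin n) ℂ) i j

/-- A right translate of the Haar measure is again a left-invariant probability measure, so
uniqueness applies. -/
instance instIsMulRightInvariantHaarU (n : ℕ) : (haarU n).IsMulRightInvariant :=
  ⟨fun g => by
    have : IsProbabilityMeasure (Measure.map (· * g) (haarU n)) :=
      Measure.isProbabilityMeasure_map (by fun_prop)
    exact Measure.isHaarMeasure_eq_of_isProbabilityMeasure _ _⟩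

lemma integrable_haarU {n : ℕ} {E : Type*} [NormedAddCommGroup E]
    {f : Matrix.unitaryGroup (Fin n) ℂ → E} (hf : Continuous f) : Integrable f (haarU n) :=
  hf.integrable_of_hasCompactSupport (HasCompactSupport.of_compactSpace f)

@[fun_prop]
lemma continuous_unitary_apply {n : ℕ} (i j : Fin n) :
    Continuous fun U : Matrix.unitaryGroup (Fin n) ℂ => entry U i j :=
  continuous_subtype_val.matrix_elem i j

/-- `∫ |U a i|² |U b i|²` -/
def haarMoment {n : ℕ} (i a b : Fin n) : ℝ :=
  ∫ U, Complex.normSq (entry U a i) * Complex.normSq (entry U b i) ∂(haarU n)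

lemma haarMoment_comm {n : ℕ} (i a b : Fin n) : haarMoment i a b = haarMoment i b a := by
  simp only [haarMoment, mul_comm]

@[fun_prop]
lemma continuous_normSq_unitary_apply {n : ℕ} (i j : Fin n) :
    Continuous fun U : Matrix.unitaryGroup (Fin n) ℂ => Complex.normSq (entry U i j) :=
  Complex.continuous_normSq.comp (continuous_unitary_apply i j)

lemma haarMoment_planeRotation {n : ℕ} (i : Fin n) {a b : Fin n} (hab : a ≠ b) {ω : ℂ}
    (hω : ω * star ω = 1) :
    ∫ U, Complex.normSq (3 / 5 * entry U a i + 4 / 5 * ω * entry U b i) ^ 2 ∂(haarU n) =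
      haarMoment i a a := by
  rw [haarMoment, ← integral_mul_left_eq_self
    (fun U => Complex.normSq (entry U a i) * Complex.normSq (entry U a i))
    ⟨planeRotation a b ω, planeRotation_mem hab hω⟩]
  congr 1
  ext U
  have : entry ((⟨planeRotation a b ω, planeRotation_mem hab hω⟩ :
      Matrix.unitaryGroup (Fin n) ℂ) * U) a i =
      3 / 5 * entry U a i + 4 / 5 * ω * entry U b i := by
    have h := planeRotation_mul_apply hab ω U.1 a i
    rwa [if_pos rfl] at h
  rw [this, sq]

/-- Summing over the fourth roots of unity removes the terms in `x ȳ` and `(x ȳ)²`; the signs `±1`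
alone would leave the latter. The cosine `3/5` and sine `4/5` keep all coefficients rational. -/
lemma sum_normSq_phases (x y : ℂ) :
    Complex.normSq (3 / 5 * x + 4 / 5 * 1 * y) ^ 2 +
      Complex.normSq (3 / 5 * x + 4 / 5 * (-1) * y) ^ 2 +
      Complex.normSq (3 / 5 * x + 4 / 5 * Complex.I * y) ^ 2 +
      Complex.normSq (3 / 5 * x + 4 / 5 * (-Complex.I) * y) ^ 2 =
    324 / 625 * (Complex.normSq x * Complex.normSq x) +
      1024 / 625 * (Complex.normSq y * Complex.normSq y) +
      2304 / 625 * (Complex.normSq x * Complex.normSq y) := by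
  have h3 : (3 / 5 : ℂ) = ((3 / 5 : ℝ) : ℂ) := by push_cast; rfl
  have h4 : (4 / 5 : ℂ) = ((4 / 5 : ℝ) : ℂ) := by push_cast; rfl
  rw [h3, h4]
  simp only [Complex.normSq_apply, Complex.add_re, Complex.add_im, Complex.mul_re,
    Complex.mul_im, Complex.ofReal_re, Complex.ofReal_im, Complex.I_re, Complex.I_im,
    Complex.neg_re, Complex.neg_im, Complex.one_re, Complex.one_im]
  ring

lemma haarMoment_rotation_relation {n : ℕ} (i : Fin n) {a b : Fin n} (hab : a ≠ b) :
    4 * haarMoment i a a = 324 / 625 * haarMoment i a a + 1024 / 625 * haarMoment i b b +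
      2304 / 625 * haarMoment i a b := by
  have hI : ∀ ω : ℂ, Integrable
      (fun U => Complex.normSq (3 / 5 * entry U a i + 4 / 5 * ω * entry U b i) ^ 2) (haarU n) := by
    intro ω
    refine integrable_haarU ((Complex.continuous_normSq.comp ?_).pow 2)
    fun_prop
  have h1 := haarMoment_planeRotation i hab (ω := 1) (by simp)
  have h2 := haarMoment_planeRotation i hab (ω := -1) (by simp)
  have h3 := haarMoment_planeRotation i hab (ω := Complex.I) (by simp)
  have h4 := haarMoment_planeRotation i hab (ω := -Complex.I) (by simp)
  have h5 : 4 * haarMoment i a a = ∫ U, (324 / 625 *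
      (Complex.normSq (entry U a i) * Complex.normSq (entry U a i)) +
      1024 / 625 * (Complex.normSq (entry U b i) * Complex.normSq (entry U b i)) +
      2304 / 625 * (Complex.normSq (entry U a i) * Complex.normSq (entry U b i))) ∂(haarU n) := by
    simp_rw [← sum_normSq_phases]
    rw [integral_add, integral_add, integral_add, h1, h2, h3, h4]
    · ring
    · exact hI _
    · exact hI _
    · exact (hI _).add (hI _)
    · exact hI _
    · exact ((hI _).add (hI _)).add (hI _)
    · exact hI _
  rw [h5, integral_add, integral_add, integral_const_mul, integral_const_mul, integral_const_mul]
  · rfl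
  all_goals exact integrable_haarU (by fun_prop)

/-- The rotation relation for `(a, b)` and for `(b, a)` is a linear system that fixes all moments of
one column up to a common factor. -/
lemma haarMoment_eq_of_ne {n : ℕ} (i : Fin n) {a b : Fin n} (hab : a ≠ b) :
    haarMoment i b b = haarMoment i a a ∧ haarMoment i a b = haarMoment i a a / 2 := by
  have h1 := haarMoment_rotation_relation i hab
  have h2 := haarMoment_rotation_relation i hab.symm
  rw [haarMoment_comm i b a] at h2
  constructor <;> linarith

lemma sum_normSq_unitary_col {n : ℕ} (U : Matrix.unitaryGroup (Fin n) ℂ) (i : Fin n) :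
    ∑ a, Complex.normSq (entry U a i) = 1 := by
  have h := congrFun (congrFun (Matrix.mem_unitaryGroup_iff'.1 U.2) i) i
  rw [Matrix.mul_apply] at h
  have h' : ((∑ a, Complex.normSq (entry U a i) : ℝ) : ℂ) = 1 := by
    rw [Matrix.one_apply_eq] at h
    rw [← h]
    push_cast
    refine Finset.sum_congr rfl fun a _ => ?_
    rw [Complex.normSq_eq_conj_mul_self]
    rfl
  exact_mod_cast h'

lemma sum_haarMoment {n : ℕ} (i a : Fin n) :
    ∑ b, haarMoment i a b = ∫ U, Complex.normSq (entry U a i) ∂(haarU n) := by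
  simp only [haarMoment]
  rw [← integral_finsetSum _ fun b _ => integrable_haarU (by fun_prop)]
  congr 1
  ext U
  rw [← Finset.mul_sum, sum_normSq_unitary_col, mul_one]

lemma sum_integral_normSq {n : ℕ} (i : Fin n) :
    ∑ a, ∫ U, Complex.normSq (entry U a i) ∂(haarU n) = 1 := by
  rw [← integral_finsetSum _ fun b _ => integrable_haarU (by fun_prop)]
  simp_rw [sum_normSq_unitary_col]
  simp

/-- Normalization of the column fixes the common factor `p`: one row of moments sums to `p + (n - 1)
p / 2`, and the `n` rows together sum to `1`. -/
lemma haarMoment_self_and_integral_normSq {n : ℕ} (i a : Fin n) :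
    haarMoment i a a = 2 / (n * (n + 1)) ∧
      ∫ U, Complex.normSq (entry U a i) ∂(haarU n) = 1 / n := by
  have hn : (0 : ℝ) < n := by exact_mod_cast Fin.pos i
  have hrow : ∀ c : Fin n, ∑ b, haarMoment i c b = (n + 1) * haarMoment i a a / 2 := by
    intro c
    have hc : haarMoment i c c = haarMoment i a a := by
      by_cases h : a = c
      · rw [h]
      · exact (haarMoment_eq_of_ne i h).1
    have : ∀ b, haarMoment i c b =
        haarMoment i a a / 2 + if b = c then haarMoment i a a / 2 else 0 := by
      intro b
      by_cases h : b = c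
      · rw [h, if_pos rfl, hc]; ring
      · rw [if_neg h, (haarMoment_eq_of_ne i (Ne.symm h)).2, hc, add_zero]
    simp_rw [this]
    rw [Finset.sum_add_distrib, Finset.sum_ite_eq' Finset.univ c]
    simp
    ring
  have htot := sum_integral_normSq i
  simp_rw [← sum_haarMoment, hrow] at htot
  rw [Finset.sum_const, Finset.card_univ, Fintype.card_fin, nsmul_eq_mul] at htot
  have hp : haarMoment i a a = 2 / (n * (n + 1)) := by
    field_simp
    linarith
  refine ⟨hp, ?_⟩
  rw [← sum_haarMoment, hrow, hp]
  field_simp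

lemma haarMoment_eq {n : ℕ} (i a b : Fin n) :
    haarMoment i a b = (1 + if a = b then 1 else 0) / (n * (n + 1)) := by
  by_cases h : a = b
  · rw [← h, (haarMoment_self_and_integral_normSq i a).1, if_pos rfl]
    norm_num
  · rw [(haarMoment_eq_of_ne i h).2, (haarMoment_self_and_integral_normSq i a).1, if_neg h]
    ring

/-- Multiplying column `i` by `I` multiplies the integrand by `I² = -1`, because column `i` enters
twice and column `j` is untouched. -/
lemma integral_mixed_columns {n : ℕ} {i j : Fin n} (hij : i ≠ j) (a b : Fin n) :
    ∫ U, (entry U a i * entry U b i) * star (entry U a j * entry U b j) ∂(haarU n) = 0 := by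
  refine integral_eq_zero_of_mul_right_eq_neg (g := ⟨phaseShift i, phaseShift_mem i⟩) fun U => ?_
  have h : ∀ c l, entry (U * (⟨phaseShift i, phaseShift_mem i⟩ : Matrix.unitaryGroup (Fin n) ℂ))
      c l = entry U c l * if l = i then Complex.I else 1 := by
    intro c l
    change (U.1 * phaseShift i) c l = _
    rw [phaseShift, Matrix.mul_diagonal]
    rfl
  rw [h, h, h, h, if_pos rfl, if_neg hij.symm, mul_one, mul_one]
  linear_combination (entry U a i * entry U b i) * star (entry U a j * entry U b j) * Complex.I_mul_I

/-- Mean square of an entry of `U (diagonal w) Uᵀ`. -/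
lemma integral_normSq_sum {n : ℕ} (w : Fin n → ℝ) (a b : Fin n) :
    ∫ U, Complex.normSq (∑ i, w i * (entry U a i * entry U b i)) ∂(haarU n) =
      (1 + if a = b then 1 else 0) / (n * (n + 1)) * ∑ i, w i ^ 2 := by
  have key : ((∫ U, Complex.normSq (∑ i, w i * (entry U a i * entry U b i)) ∂(haarU n) : ℝ) : ℂ) =
      ∑ i, ((w i ^ 2 * haarMoment i a b : ℝ) : ℂ) := by
    rw [← integral_complex_ofReal]
    have h1 : ∀ U : Matrix.unitaryGroup (Fin n) ℂ,
        ((Complex.normSq (∑ i, w i * (entry U a i * entry U b i)) : ℝ) : ℂ) =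
        ∑ i, ∑ j, (w i * w j : ℂ) * ((entry U a i * entry U b i) * star (entry U a j * entry U b j)) := by
      intro U
      rw [← Complex.mul_conj, map_sum, Finset.sum_mul_sum]
      refine Finset.sum_congr rfl fun i _ => Finset.sum_congr rfl fun j _ => ?_
      simp only [map_mul, Complex.conj_ofReal, Complex.star_def]
      ring
    have hcont : ∀ i j : Fin n, Continuous fun U : Matrix.unitaryGroup (Fin n) ℂ =>
        (entry U a i * entry U b i) * star (entry U a j * entry U b j) := fun i j => by fun_prop
    calc _ = ∫ U, ∑ i, ∑ j, (w i * w j : ℂ) *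
          ((entry U a i * entry U b i) * star (entry U a j * entry U b j)) ∂(haarU n) :=
          integral_congr_ae (Eventually.of_forall h1)
      _ = ∑ i, ∑ j, (w i * w j : ℂ) *
          ∫ U, (entry U a i * entry U b i) * star (entry U a j * entry U b j) ∂(haarU n) := by
          rw [integral_finsetSum _ fun i _ => integrable_finsetSum _ fun j _ =>
            (integrable_haarU (hcont i j)).const_mul _]
          refine Finset.sum_congr rfl fun i _ => ?_
          rw [integral_finsetSum _ fun j _ => (integrable_haarU (hcont i j)).const_mul _]
          refine Finset.sum_congr rfl fun j _ => ?_
          rw [integral_const_mul]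
      _ = _ := by
          refine Finset.sum_congr rfl fun i _ => ?_
          rw [Finset.sum_eq_single i]
          · have : ∀ U : Matrix.unitaryGroup (Fin n) ℂ,
                (entry U a i * entry U b i) * star (entry U a i * entry U b i) =
                ((Complex.normSq (entry U a i) * Complex.normSq (entry U b i) : ℝ) : ℂ) := by
              intro U
              rw [Complex.star_def, Complex.mul_conj, Complex.normSq_mul]
            simp_rw [this]
            rw [integral_complex_ofReal, haarMoment]
            push_cast
            ring
          · intro j _ hj
            rw [integral_mixed_columns (Ne.symm hj), mul_zero]
          · simp
  have key' : ∫ U, Complex.normSq (∑ i, w i * (entry U a i * entry U b i)) ∂(haarU n) =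
      ∑ i, w i ^ 2 * haarMoment i a b := by exact_mod_cast key
  rw [key', Finset.mul_sum]
  refine Finset.sum_congr rfl fun i _ => ?_
  rw [haarMoment_eq]
  ring

/-! ### Traces, norms and determinants of real symmetric matrices -/

/-- The compression `V (diagonal f) Vᵀ` of a diagonal matrix. -/
def compress {ι κ : Type*} [Fintype κ] [DecidableEq κ] (V : Matrix ι κ ℝ) (f : κ → ℝ) : Matrix ι ι ℝ :=
  V * Matrix.diagonal f * V.transpose

lemma compress_add {ι κ : Type*} [Fintype κ] [DecidableEq κ] (V : Matrix ι κ ℝ) (f g : κ → ℝ) :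
    compress V (f + g) = compress V f + compress V g := by
  have : (Matrix.diagonal (f + g) : Matrix κ κ ℝ) = Matrix.diagonal f + Matrix.diagonal g :=
    (Matrix.diagonal_add f g).symm
  rw [compress, this, Matrix.mul_add, Matrix.add_mul]
  rfl

lemma compress_const {ι κ : Type*} [DecidableEq ι] [Fintype κ] [DecidableEq κ]
    {V : Matrix ι κ ℝ} (hV : V * V.transpose = 1) (c : ℝ) :
    compress V (fun _ => c) = c • (1 : Matrix ι ι ℝ) := by
  rw [compress, ← Matrix.smul_one_eq_diagonal, Matrix.mul_smul, Matrix.mul_one, Matrix.smul_mul, hV]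

lemma isHermitian_compress {ι κ : Type*} [Fintype κ] [DecidableEq κ]
    (V : Matrix ι κ ℝ) (f : κ → ℝ) : (compress V f).IsHermitian := by
  simp [Matrix.IsHermitian, compress, Matrix.mul_assoc, Matrix.conjTranspose_eq_transpose_of_trivial]

section Spectral

open scoped Matrix.Norms.L2Operator

variable {ι κ : Type*} [Fintype ι] [DecidableEq ι] [Fintype κ] [DecidableEq κ]

/-- The `d i` are the eigenvalues. The shift `c` is free because the determinant is expanded both
around `1` and around `cosh x`. -/
lemma exists_spectral_values {A : Matrix ι ι ℝ} (hA : A.IsHermitian) :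
    ∃ d : ι → ℝ, (∀ i, |d i| ≤ ‖A‖) ∧ (∀ c : ℝ, (c • (1 : Matrix ι ι ℝ) + A).det = ∏ i, (c + d i)) ∧
      ∀ j : ℕ, (A ^ j).trace = ∑ i, d i ^ j := by
  set Q : Matrix ι ι ℝ := hA.eigenvectorUnitary.1 with hQ
  set d := hA.eigenvalues with hd
  have h1 : Q * star Q = 1 := Matrix.mem_unitaryGroup_iff.1 hA.eigenvectorUnitary.2
  have h2 : star Q * Q = 1 := Matrix.mem_unitaryGroup_iff'.1 hA.eigenvectorUnitary.2
  have hAQ : A = Q * Matrix.diagonal d * star Q := by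
    have h := hA.spectral_theorem
    rw [Unitary.conjStarAlgAut_apply] at h
    exact h
  have hdA : Matrix.diagonal d = star Q * A * Q := by
    rw [hAQ]
    calc Matrix.diagonal d = (star Q * Q) * Matrix.diagonal d * (star Q * Q) := by
          rw [h2, one_mul, mul_one]
      _ = _ := by simp only [mul_assoc]
  have hpow : ∀ j : ℕ, A ^ j = Q * Matrix.diagonal (fun i => d i ^ j) * star Q := by
    intro j
    induction j with
    | zero => simp [h1]
    | succ j ih =>
      rw [pow_succ, ih]
      calc _ = Q * Matrix.diagonal (fun i => d i ^ j) * star Q *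
            (Q * Matrix.diagonal d * star Q) := by rw [← hAQ]
        _ = Q * Matrix.diagonal (fun i => d i ^ j) * (star Q * Q) *
            Matrix.diagonal d * star Q := by simp only [mul_assoc]
        _ = _ := by
          rw [h2, mul_one, mul_assoc Q, Matrix.diagonal_mul_diagonal]
          simp only [pow_succ]
  refine ⟨d, fun i => ?_, fun c => ?_, fun j => ?_⟩
  · calc |d i| ≤ ‖d‖ := norm_le_pi_norm d i
      _ = ‖(Matrix.diagonal d : Matrix ι ι ℝ)‖ := (Matrix.l2_opNorm_diagonal d).symm
      _ = ‖star Q * A * Q‖ := by rw [hdA]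
      _ = ‖star Q * A‖ := CStarRing.norm_mul_mem_unitary _ hA.eigenvectorUnitary.2
      _ = ‖A‖ := CStarRing.norm_mem_unitary_mul _ (Unitary.star_mem hA.eigenvectorUnitary.2)
  · have : c • (1 : Matrix ι ι ℝ) + A = Q * Matrix.diagonal (fun i => c + d i) * star Q := by
      have hdiag : (Matrix.diagonal (fun i => c + d i) : Matrix ι ι ℝ) =
          c • 1 + Matrix.diagonal d := by
        rw [← Matrix.diagonal_add, Matrix.smul_one_eq_diagonal]
      rw [hdiag, mul_add, add_mul, ← hAQ, mul_smul_comm, mul_one, smul_mul_assoc, h1]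
    rw [this, Matrix.det_mul, Matrix.det_mul, mul_right_comm, ← Matrix.det_mul, h1,
      Matrix.det_one, one_mul, Matrix.det_diagonal]
  · rw [hpow, Matrix.trace_mul_comm, ← mul_assoc, h2, one_mul, Matrix.trace_diagonal]

lemma abs_trace_le {A : Matrix ι ι ℝ} (hA : A.IsHermitian) :
    |A.trace| ≤ Fintype.card ι * ‖A‖ := by
  obtain ⟨d, hd, -, htr⟩ := exists_spectral_values hA
  have h := htr 1
  simp only [pow_one] at h
  rw [h]
  calc |∑ i, d i| ≤ ∑ i, |d i| := Finset.abs_sum_le_sum_abs _ _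
    _ ≤ ∑ _i : ι, ‖A‖ := Finset.sum_le_sum fun i _ => hd i
    _ = _ := by simp

lemma abs_log_one_add_sub_le {x : ℝ} (hx : |x| ≤ 1 / 2) :
    |Real.log (1 + x) - (x - x ^ 2 / 2 + x ^ 3 / 3)| ≤ 2 * |x| ^ 4 := by
  have h := Real.abs_log_sub_add_sum_range_le (x := -x) (by rw [abs_neg]; linarith) 3
  simp only [Finset.sum_range_succ, Finset.sum_range_zero, abs_neg, sub_neg_eq_add] at h
  have h2 : |x| ^ (3 + 1) / (1 - |x|) ≤ 2 * |x| ^ 4 := by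
    rw [div_le_iff₀ (by linarith)]
    have : 0 ≤ |x| ^ 4 := by positivity
    norm_num
    nlinarith
  refine le_trans (le_of_eq ?_) (h.trans h2)
  congr 1
  push_cast
  ring

lemma abs_log_det_one_add_sub_le {A : Matrix ι ι ℝ} (hA : A.IsHermitian) {ε : ℝ}
    (hn : ‖A‖ ≤ ε) (hε : ε ≤ 1 / 2) :
    |Real.log (1 + A).det - (A.trace - (A ^ 2).trace / 2 + (A ^ 3).trace / 3)| ≤
      Fintype.card ι * (2 * ε ^ 4) := by
  obtain ⟨d, hd, hdet, htr⟩ := exists_spectral_values hA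
  have h1 := htr 1
  simp only [pow_one] at h1
  have hd2 : ∀ i, |d i| ≤ 1 / 2 := fun i => (hd i).trans (hn.trans hε)
  have hdet1 := hdet 1
  rw [one_smul] at hdet1
  rw [hdet1, h1, htr 2, htr 3, Real.log_prod (fun i _ => by
    have := abs_le.1 (hd2 i); linarith), Finset.sum_div, Finset.sum_div, ← Finset.sum_sub_distrib,
    ← Finset.sum_add_distrib, ← Finset.sum_sub_distrib]
  calc _ ≤ ∑ i, |Real.log (1 + d i) - (d i - d i ^ 2 / 2 + d i ^ 3 / 3)| :=
        Finset.abs_sum_le_sum_abs _ _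
    _ ≤ ∑ _i : ι, 2 * ε ^ 4 := Finset.sum_le_sum fun i _ =>
        (abs_log_one_add_sub_le (hd2 i)).trans (by
          have := (hd i).trans hn
          gcongr)
    _ = _ := by simp

/-- If `A - cosh x` has norm at most `sinh x`, then the eigenvalues of `A` lie in
`[exp (-x), exp x]`. -/
lemma det_pos_and_abs_log_det_le {A : Matrix ι ι ℝ} (hA : A.IsHermitian) {x : ℝ}
    (hn : ‖A - Real.cosh x • (1 : Matrix ι ι ℝ)‖ ≤ Real.sinh x) :
    0 < A.det ∧ |Real.log A.det| ≤ Fintype.card ι * x := by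
  have hB : (A - Real.cosh x • (1 : Matrix ι ι ℝ)).IsHermitian := by
    refine hA.sub ?_
    simp [Matrix.IsHermitian]
  obtain ⟨d, hd, hdet, -⟩ := exists_spectral_values hB
  have hA' := hdet (Real.cosh x)
  rw [add_sub_cancel] at hA'
  have hlow : ∀ i, Real.exp (-x) ≤ Real.cosh x + d i := by
    intro i
    have := (abs_le.1 ((hd i).trans hn)).1
    rw [← Real.cosh_sub_sinh]
    linarith
  have hupp : ∀ i, Real.cosh x + d i ≤ Real.exp x := by
    intro i
    have := (abs_le.1 ((hd i).trans hn)).2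
    rw [← Real.cosh_add_sinh]
    linarith
  have hpos : ∀ i, 0 < Real.cosh x + d i := fun i => (Real.exp_pos _).trans_le (hlow i)
  rw [hA']
  refine ⟨Finset.prod_pos fun i _ => hpos i, ?_⟩
  rw [Real.log_prod fun i _ => (hpos i).ne']
  calc _ ≤ ∑ i, |Real.log (Real.cosh x + d i)| := Finset.abs_sum_le_sum_abs _ _
    _ ≤ ∑ _i : ι, x := Finset.sum_le_sum fun i _ => by
        rw [abs_le]
        exact ⟨(Real.le_log_iff_exp_le (hpos i)).2 (hlow i),
          (Real.log_le_iff_le_exp (hpos i)).2 (hupp i)⟩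
    _ = _ := by simp

/-- `V` is a coisometry, so compression by it does not increase the operator norm. -/
lemma norm_compress_le {V : Matrix ι κ ℝ} (hV : V * V.transpose = 1) {f : κ → ℝ} {c : ℝ}
    (hc : 0 ≤ c) (hf : ∀ i, |f i| ≤ c) : ‖compress V f‖ ≤ c := by
  have hVT : V.transpose = V.conjTranspose :=
    (Matrix.conjTranspose_eq_transpose_of_trivial V).symm
  -- Only an inequality: for empty `ι` (the case `k = 0`) this norm is `0`.
  have h1 : ‖(1 : Matrix ι ι ℝ)‖ ≤ 1 := by
    rw [← Matrix.diagonal_one, Matrix.l2_opNorm_diagonal, pi_norm_le_iff_of_nonneg zero_le_one]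
    simp
  have h2 : ‖V.conjTranspose‖ * ‖V.conjTranspose‖ ≤ 1 := by
    rw [← Matrix.l2_opNorm_conjTranspose_mul_self, Matrix.conjTranspose_conjTranspose, ← hVT, hV]
    exact h1
  have h3 : ‖V‖ = ‖V.conjTranspose‖ := (Matrix.l2_opNorm_conjTranspose V).symm
  have h4 : ‖(Matrix.diagonal f : Matrix κ κ ℝ)‖ ≤ c := by
    rw [Matrix.l2_opNorm_diagonal]
    exact (pi_norm_le_iff_of_nonneg hc).2 hf
  calc ‖compress V f‖ ≤ ‖V * Matrix.diagonal f‖ * ‖V.transpose‖ := Matrix.l2_opNorm_mul _ _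
    _ ≤ ‖V‖ * ‖(Matrix.diagonal f : Matrix κ κ ℝ)‖ * ‖V.transpose‖ := by
        gcongr
        exact Matrix.l2_opNorm_mul _ _
    _ = (‖V.conjTranspose‖ * ‖V.conjTranspose‖) * ‖(Matrix.diagonal f : Matrix κ κ ℝ)‖ := by
        rw [h3, hVT]; ring
    _ ≤ 1 * c := by gcongr
    _ = c := one_mul c

/-- Conjugation by `J` preserves the trace but reverses the sign of `X`. -/
lemma trace_eq_zero_of_anticommute {J X : Matrix ι ι ℝ} (hJ : J.transpose * J = 1)
    (h : J * X = -(X * J)) : X.trace = 0 := by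
  have hJ' : J * J.transpose = 1 := mul_eq_one_comm.1 hJ
  have : X.trace = -X.trace := by
    calc X.trace = (J.transpose * J * X).trace := by rw [hJ, one_mul]
      _ = (J.transpose * -(X * J)).trace := by rw [Matrix.mul_assoc, h]
      _ = -(X * (J * J.transpose)).trace := by
          rw [Matrix.mul_neg, Matrix.trace_neg, Matrix.trace_mul_comm, Matrix.mul_assoc]
      _ = -X.trace := by rw [hJ', mul_one]
  linarith

/-- Third order expansion of `log det (1 + C + D)` when an orthogonal `J` commutes with `C` and
anticommutes with `D`: the terms of odd order in `D` have trace zero. -/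
lemma abs_log_det_sub_le_of_anticommute {J C D : Matrix ι ι ℝ} (hJ : J.transpose * J = 1)
    (hC : C.IsHermitian) (hD : D.IsHermitian) (hJC : J * C = C * J) (hJD : J * D = -(D * J))
    {δ : ℝ} (hδ : δ ≤ 1 / 4) (hCn : ‖C‖ ≤ δ ^ 2) (hDn : ‖D‖ ≤ δ) :
    |Real.log (1 + (C + D)).det - (C.trace - (D ^ 2).trace / 2)| ≤
      Fintype.card ι * (40 * δ ^ 4) := by
  have hδ0 : 0 ≤ δ := (norm_nonneg _).trans hDn
  have hA : (C + D).IsHermitian := hC.add hD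
  have hAn : ‖C + D‖ ≤ 2 * δ := (norm_add_le _ _).trans (by nlinarith)
  have hlog := abs_log_det_one_add_sub_le hA hAn (by linarith)
  have hCD : (C * D).trace = 0 := trace_eq_zero_of_anticommute hJ (by
    rw [← mul_assoc, hJC, mul_assoc, hJD, mul_neg, mul_assoc])
  have hCCD : (C * C * D).trace = 0 := trace_eq_zero_of_anticommute hJ (by
    rw [← mul_assoc, ← mul_assoc, hJC, mul_assoc C J, hJC, mul_assoc, mul_assoc, hJD]
    simp only [mul_neg, mul_assoc])
  have hDDD : (D * D * D).trace = 0 := trace_eq_zero_of_anticommute hJ (by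
    have h : ∀ X, J * (D * X) = -(D * (J * X)) := fun X => by
      rw [← mul_assoc, hJD, neg_mul, mul_assoc]
    simp only [mul_assoc, h, hJD, mul_neg, neg_neg])
  have hDt : D.trace = 0 := trace_eq_zero_of_anticommute hJ hJD
  have ht2 : ((C + D) ^ 2).trace = (C ^ 2).trace + (D ^ 2).trace := by
    have : (C + D) ^ 2 = C ^ 2 + C * D + D * C + D ^ 2 := by noncomm_ring
    rw [this, Matrix.trace_add, Matrix.trace_add, Matrix.trace_add, Matrix.trace_mul_comm D C, hCD]
    ring
  have ht3 : ((C + D) ^ 3).trace = (C ^ 3).trace + 3 * (D * C * D).trace := by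
    have : (C + D) ^ 3 = C ^ 3 + C * C * D + C * D * C + D * (C * C) + C * D * D + D * C * D +
        D * (D * C) + D * D * D := by noncomm_ring
    have e1 : (C * D * C).trace = (C * C * D).trace := by
      rw [Matrix.trace_mul_comm, ← mul_assoc]
    have e2 : (D * (C * C)).trace = (C * C * D).trace := Matrix.trace_mul_comm _ _
    have e3 : (C * D * D).trace = (D * C * D).trace := by
      rw [Matrix.trace_mul_comm, ← mul_assoc]
    have e4 : (D * (D * C)).trace = (D * C * D).trace := Matrix.trace_mul_comm _ _
    simp only [this, Matrix.trace_add, e1, e2, e3, e4, hCCD, hDDD]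
    ring
  have hN : (0 : ℝ) ≤ Fintype.card ι := by positivity
  have b2 : |(C ^ 2).trace| ≤ Fintype.card ι * δ ^ 4 := by
    refine (abs_trace_le (hC.pow 2)).trans (mul_le_mul_of_nonneg_left ?_ hN)
    calc ‖C ^ 2‖ ≤ ‖C‖ ^ 2 := norm_pow_le' C two_pos
      _ ≤ (δ ^ 2) ^ 2 := by gcongr
      _ = δ ^ 4 := by ring
  have b3 : |(C ^ 3).trace| ≤ Fintype.card ι * δ ^ 4 := by
    refine (abs_trace_le (hC.pow 3)).trans (mul_le_mul_of_nonneg_left ?_ hN)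
    calc ‖C ^ 3‖ ≤ ‖C‖ ^ 3 := norm_pow_le' C three_pos
      _ ≤ (δ ^ 2) ^ 3 := by gcongr
      _ = δ ^ 4 * δ ^ 2 := by ring
      _ ≤ δ ^ 4 * 1 := by gcongr; nlinarith
      _ = δ ^ 4 := mul_one _
  have bm : |(D * C * D).trace| ≤ Fintype.card ι * δ ^ 4 := by
    have hH : (D * C * D).IsHermitian := by
      have hC' : C.conjTranspose = C := hC
      have hD' : D.conjTranspose = D := hD
      rw [Matrix.IsHermitian, Matrix.conjTranspose_mul, Matrix.conjTranspose_mul, hC', hD',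
        mul_assoc]
    refine (abs_trace_le hH).trans (mul_le_mul_of_nonneg_left ?_ hN)
    calc ‖D * C * D‖ ≤ ‖D‖ * ‖C‖ * ‖D‖ := norm_mul₃_le
      _ ≤ δ * δ ^ 2 * δ := by gcongr
      _ = δ ^ 4 := by ring
  -- The surviving fourth-order terms are `32` from the Taylor remainder and `1/2`, `1/3`, `1` from
  -- `C²`, `C³`, `D C D`; their sum is below `40`.
  rw [Matrix.trace_add, hDt, ht2, ht3] at hlog
  have e : (Fintype.card ι : ℝ) * (2 * (2 * δ) ^ 4) = 32 * (Fintype.card ι * δ ^ 4) := by ring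
  rw [e] at hlog
  have e' : (Fintype.card ι : ℝ) * (40 * δ ^ 4) = 40 * (Fintype.card ι * δ ^ 4) := by ring
  rw [e']
  rw [abs_le] at *
  constructor <;> linarith [hlog.1, hlog.2, b2.1, b2.2, b3.1, b3.2, bm.1, bm.2]

end Spectral

/-! ### The reduced covariance matrix as a compression -/

section Blocks

variable {ι κ : Type*} [Fintype κ] [DecidableEq κ]

lemma compress_fromBlocks (X Y : Matrix ι κ ℝ) (f g : κ → ℝ) :
    compress (Matrix.fromBlocks X Y (-Y) X) (Sum.elim f g) =
      Matrix.fromBlocks (compress X f + compress Y g)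
        (Y * Matrix.diagonal g * X.transpose - X * Matrix.diagonal f * Y.transpose)
        (X * Matrix.diagonal g * Y.transpose - Y * Matrix.diagonal f * X.transpose)
        (compress Y f + compress X g) := by
  rw [compress, ← Matrix.fromBlocks_diagonal, Matrix.fromBlocks_transpose,
    Matrix.fromBlocks_multiply, Matrix.fromBlocks_multiply]
  simp only [Matrix.mul_zero, add_zero, zero_add, Matrix.transpose_neg, Matrix.mul_neg,
    Matrix.neg_mul, neg_neg, compress]
  congr 1 <;> abel

lemma compress_neg (X : Matrix ι κ ℝ) (f : κ → ℝ) : compress X (-f) = -compress X f := by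
  have : (Matrix.diagonal (-f) : Matrix κ κ ℝ) = -Matrix.diagonal f :=
    (Matrix.diagonal_neg f).symm
  rw [compress, this, Matrix.mul_neg, Matrix.neg_mul, compress]

lemma mul_diagonal_mul_transpose_apply (X Y : Matrix ι κ ℝ) (f : κ → ℝ) (a b : ι) :
    (X * Matrix.diagonal f * Y.transpose) a b = ∑ i, f i * (X a i * Y b i) := by
  rw [Matrix.mul_apply]
  refine Finset.sum_congr rfl fun i _ => ?_
  rw [Matrix.mul_diagonal, Matrix.transpose_apply]
  ring

end Blocks

/-- The symplectic form, as a matrix. -/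
def symplecticJ (ι : Type*) [DecidableEq ι] : Matrix (ι ⊕ ι) (ι ⊕ ι) ℝ :=
  Matrix.fromBlocks 0 1 (-1) 0

section Symplectic

variable {ι κ : Type*} [Fintype ι] [DecidableEq ι] [Fintype κ] [DecidableEq κ]

lemma symplecticJ_transpose_mul_self : (symplecticJ ι).transpose * symplecticJ ι = 1 := by
  simp [symplecticJ, Matrix.fromBlocks_transpose, Matrix.fromBlocks_multiply,
    Matrix.fromBlocks_one]

/-- Blocks of the form `(X, Y; -Y, X)` are complex linear, so they intertwine the symplectic forms
on both sides. What remains is that the form commutes with `diag(w, w)` and, in the next lemma,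
anticommutes with `diag(w, -w)`. -/
lemma symplecticJ_commute (X Y : Matrix ι κ ℝ) (w : κ → ℝ) :
    symplecticJ ι * compress (Matrix.fromBlocks X Y (-Y) X) (Sum.elim w w) =
      compress (Matrix.fromBlocks X Y (-Y) X) (Sum.elim w w) * symplecticJ ι := by
  rw [compress_fromBlocks, symplecticJ, Matrix.fromBlocks_multiply, Matrix.fromBlocks_multiply]
  simp [add_comm]

lemma symplecticJ_anticommute (X Y : Matrix ι κ ℝ) (w : κ → ℝ) :
    symplecticJ ι * compress (Matrix.fromBlocks X Y (-Y) X) (Sum.elim w (-w)) =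
      -(compress (Matrix.fromBlocks X Y (-Y) X) (Sum.elim w (-w)) * symplecticJ ι) := by
  have hd : (Matrix.diagonal (-w) : Matrix κ κ ℝ) = -Matrix.diagonal w :=
    (Matrix.diagonal_neg w).symm
  rw [compress_fromBlocks, symplecticJ, Matrix.fromBlocks_multiply, Matrix.fromBlocks_multiply,
    Matrix.fromBlocks_neg, hd]
  simp only [compress_neg, sub_eq_add_neg, Matrix.mul_neg, Matrix.neg_mul, Matrix.one_mul,
    Matrix.mul_one, Matrix.zero_mul, Matrix.mul_zero, zero_add, add_zero, neg_add, neg_neg]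
  congr 1 <;> abel

end Symplectic

/-- The first `k` rows of the phase-space action of `U`. -/
def frame (k : ℕ) {n : ℕ} (U : Matrix.unitaryGroup (Fin n) ℂ) :
    Matrix (Fin k ⊕ Fin k) (Fin n ⊕ Fin n) ℝ :=
  Matrix.fromBlocks (selectModes k n) 0 0 (selectModes k n) *
    passive (U : Matrix (Fin n) (Fin n) ℂ)

lemma selectModes_mul {k n : ℕ} (h : k ≤ n) (M : Matrix (Fin n) (Fin n) ℝ) :
    selectModes k n * M = M.submatrix (Fin.castLE h) id := by
  ext a i
  rw [Matrix.mul_apply, Finset.sum_eq_single (Fin.castLE h a)]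
  · simp [selectModes]
  · intro j _ hj
    have : (a : ℕ) ≠ (j : ℕ) := fun e => hj (Fin.ext e.symm)
    simp [selectModes, this]
  · simp

/-- Real parts of the first `k` rows of `U`. -/
def rowsRe {k n : ℕ} (h : k ≤ n) (U : Matrix.unitaryGroup (Fin n) ℂ) : Matrix (Fin k) (Fin n) ℝ :=
  Matrix.of fun a i => (entry U (Fin.castLE h a) i).re

/-- Imaginary parts of the first `k` rows of `U`. -/
def rowsIm {k n : ℕ} (h : k ≤ n) (U : Matrix.unitaryGroup (Fin n) ℂ) : Matrix (Fin k) (Fin n) ℝ :=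
  Matrix.of fun a i => (entry U (Fin.castLE h a) i).im

lemma frame_eq {k n : ℕ} (h : k ≤ n) (U : Matrix.unitaryGroup (Fin n) ℂ) :
    frame k U = Matrix.fromBlocks (rowsRe h U) (rowsIm h U) (-rowsIm h U) (rowsRe h U) := by
  have h1 : selectModes k n * U.1.map Complex.re = rowsRe h U := selectModes_mul h _
  have h2 : selectModes k n * U.1.map Complex.im = rowsIm h U := selectModes_mul h _
  rw [frame, passive, Matrix.fromBlocks_multiply, Matrix.mul_neg, h1, h2]
  simpa using h2

lemma sum_entry_mul_star {n : ℕ} (U : Matrix.unitaryGroup (Fin n) ℂ) (a b : Fin n) :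
    ∑ i, entry U a i * star (entry U b i) = if a = b then 1 else 0 := by
  have h := congrFun (congrFun (Matrix.mem_unitaryGroup_iff.1 U.2) a) b
  rw [Matrix.mul_apply, Matrix.one_apply] at h
  exact h

/-- The real and imaginary parts of the orthonormality of the first `k` rows of `U` are exactly the
blocks of this identity. -/
lemma frame_mul_transpose {k n : ℕ} (h : k ≤ n) (U : Matrix.unitaryGroup (Fin n) ℂ) :
    frame k U * (frame k U).transpose = 1 := by
  have hcompress : frame k U * (frame k U).transpose =
      compress (frame k U) (Sum.elim (fun _ => 1) (fun _ => 1)) := by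
    rw [compress, Sum.elim_lam_const_lam_const, Matrix.diagonal_one, Matrix.mul_one]
  have key : ∀ a b : Fin k, ∑ i, entry U (Fin.castLE h a) i * star (entry U (Fin.castLE h b) i) =
      if a = b then 1 else 0 := by
    intro a b
    rw [sum_entry_mul_star]
    simp
  have hre : ∀ a b : Fin k, ∑ i, ((entry U (Fin.castLE h a) i).re * (entry U (Fin.castLE h b) i).re +
      (entry U (Fin.castLE h a) i).im * (entry U (Fin.castLE h b) i).im) =
      if a = b then 1 else 0 := by
    intro a b
    have := congrArg Complex.re (key a b)
    simpa [apply_ite Complex.re] using this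
  have him : ∀ a b : Fin k, ∑ i, ((entry U (Fin.castLE h a) i).im * (entry U (Fin.castLE h b) i).re -
      (entry U (Fin.castLE h a) i).re * (entry U (Fin.castLE h b) i).im) = 0 := by
    intro a b
    have := congrArg Complex.im (key a b)
    simp only [Complex.im_sum, Complex.star_def, Complex.mul_im, Complex.conj_re, Complex.conj_im,
      apply_ite Complex.im, Complex.one_im, Complex.zero_im, ite_self] at this
    rw [← this]
    refine Finset.sum_congr rfl fun i _ => by ring
  rw [hcompress, frame_eq h, compress_fromBlocks, ← Matrix.fromBlocks_one]
  congr 1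
  · ext a b
    rw [Matrix.add_apply, compress, compress, mul_diagonal_mul_transpose_apply,
      mul_diagonal_mul_transpose_apply, ← Finset.sum_add_distrib, Matrix.one_apply, ← hre a b]
    simp [rowsRe, rowsIm]
  · ext a b
    rw [Matrix.sub_apply, mul_diagonal_mul_transpose_apply,
      mul_diagonal_mul_transpose_apply, ← Finset.sum_sub_distrib, Matrix.zero_apply, ← him a b]
    simp [rowsRe, rowsIm]
  · ext a b
    rw [Matrix.sub_apply, mul_diagonal_mul_transpose_apply,
      mul_diagonal_mul_transpose_apply, ← Finset.sum_sub_distrib, Matrix.zero_apply, ← him b a]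
    simp [rowsRe, rowsIm, mul_comm]
  · ext a b
    rw [Matrix.add_apply, compress, compress, mul_diagonal_mul_transpose_apply,
      mul_diagonal_mul_transpose_apply, ← Finset.sum_add_distrib, Matrix.one_apply, ← hre a b]
    simp [rowsRe, rowsIm, add_comm]

lemma trace_fromBlocks {ι : Type*} [Fintype ι] (A B C D : Matrix ι ι ℝ) :
    (Matrix.fromBlocks A B C D).trace = A.trace + D.trace := by
  simp [Matrix.trace]

lemma trace_compress_frame {k n : ℕ} (h : k ≤ n) (U : Matrix.unitaryGroup (Fin n) ℂ)
    (w : Fin n → ℝ) :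
    (compress (frame k U) (Sum.elim w w)).trace =
      2 * ∑ a : Fin k, ∑ i, w i * Complex.normSq (entry U (Fin.castLE h a) i) := by
  rw [frame_eq h, compress_fromBlocks, trace_fromBlocks, Matrix.trace_add, Matrix.trace_add]
  have : (compress (rowsRe h U) w).trace + (compress (rowsIm h U) w).trace =
      ∑ a : Fin k, ∑ i, w i * Complex.normSq (entry U (Fin.castLE h a) i) := by
    rw [Matrix.trace, Matrix.trace, ← Finset.sum_add_distrib]
    refine Finset.sum_congr rfl fun a _ => ?_
    rw [Matrix.diag_apply, Matrix.diag_apply, compress, compress, mul_diagonal_mul_transpose_apply,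
      mul_diagonal_mul_transpose_apply, ← Finset.sum_add_distrib]
    refine Finset.sum_congr rfl fun i _ => ?_
    rw [Complex.normSq_apply, rowsRe, rowsIm, Matrix.of_apply, Matrix.of_apply]
    ring
  linarith

/-- The compression has blocks `±Re T`, `-Im T` for the complex symmetric matrix `T`, the leading `k
× k` corner of `U diag(w) Uᵀ`. The trace of its square is therefore twice the squared
Hilbert–Schmidt norm of `T`. -/
lemma trace_compress_frame_sq {k n : ℕ} (h : k ≤ n) (U : Matrix.unitaryGroup (Fin n) ℂ)
    (w : Fin n → ℝ) :
    (compress (frame k U) (Sum.elim w (-w)) ^ 2).trace =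
      2 * ∑ a : Fin k, ∑ b : Fin k, Complex.normSq
        (∑ i, w i * (entry U (Fin.castLE h a) i * entry U (Fin.castLE h b) i)) := by
  set T : Fin k → Fin k → ℂ := fun a b =>
    ∑ i, w i * (entry U (Fin.castLE h a) i * entry U (Fin.castLE h b) i) with hT
  have hsymm : ∀ a b, T a b = T b a := fun a b => by
    simp only [hT, mul_comm (entry U (Fin.castLE h a) _)]
  have hD : compress (frame k U) (Sum.elim w (-w)) =
      Matrix.fromBlocks (Matrix.of fun a b => (T a b).re) (Matrix.of fun a b => -(T a b).im)
        (Matrix.of fun a b => -(T a b).im) (Matrix.of fun a b => -(T a b).re) := by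
    rw [frame_eq h, compress_fromBlocks]
    congr 1
    all_goals
      ext a b
      simp only [Matrix.add_apply, Matrix.sub_apply, compress, mul_diagonal_mul_transpose_apply,
        ← Finset.sum_add_distrib, ← Finset.sum_sub_distrib, Matrix.of_apply, hT, Complex.re_sum,
        Complex.im_sum, ← Finset.sum_neg_distrib, rowsRe, rowsIm]
      refine Finset.sum_congr rfl fun i _ => ?_
      simp only [Complex.mul_re, Complex.mul_im, Complex.ofReal_re, Complex.ofReal_im,
        Pi.neg_apply]
      ring
  rw [hD, sq, Matrix.fromBlocks_multiply, trace_fromBlocks, Matrix.trace, Matrix.trace,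
    ← Finset.sum_add_distrib, Finset.mul_sum]
  refine Finset.sum_congr rfl fun a _ => ?_
  simp only [Matrix.diag_apply, Matrix.add_apply, Matrix.mul_apply, Matrix.of_apply]
  rw [← Finset.sum_add_distrib, ← Finset.sum_add_distrib, ← Finset.sum_add_distrib, Finset.mul_sum]
  refine Finset.sum_congr rfl fun b _ => ?_
  rw [hsymm b a, Complex.normSq_apply]
  ring

lemma integral_trace_compress_frame {k n : ℕ} (h : k ≤ n) (w : Fin n → ℝ) :
    ∫ U, (compress (frame k U) (Sum.elim w w)).trace ∂(haarU n) = 2 * ratio k n * ∑ i, w i := by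
  simp_rw [trace_compress_frame h]
  rw [integral_const_mul, integral_finsetSum _ fun a _ => integrable_haarU (by fun_prop)]
  have : ∀ a : Fin k, ∫ U, ∑ i, w i * Complex.normSq (entry U (Fin.castLE h a) i) ∂(haarU n) =
      1 / n * ∑ i, w i := by
    intro a
    rw [integral_finsetSum _ fun a _ => integrable_haarU (by fun_prop), Finset.mul_sum]
    refine Finset.sum_congr rfl fun i _ => ?_
    rw [integral_const_mul, (haarMoment_self_and_integral_normSq i _).2]
    ring
  simp_rw [this]
  rw [Finset.sum_const, Finset.card_univ, Fintype.card_fin, nsmul_eq_mul, ratio]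
  ring

lemma continuous_normSq_sum {n : ℕ} (w : Fin n → ℝ) (a b : Fin n) :
    Continuous fun U : Matrix.unitaryGroup (Fin n) ℂ =>
      Complex.normSq (∑ i, w i * (entry U a i * entry U b i)) :=
  Complex.continuous_normSq.comp (by fun_prop)

lemma integral_trace_compress_frame_sq {k n : ℕ} (h : k ≤ n) (w : Fin n → ℝ) :
    ∫ U, (compress (frame k U) (Sum.elim w (-w)) ^ 2).trace ∂(haarU n) =
      2 * (ratio k n * ((k + 1) / (n + 1))) * ∑ i, w i ^ 2 := by
  simp_rw [trace_compress_frame_sq h]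
  rw [integral_const_mul, integral_finsetSum _ fun a _ => integrable_haarU
    (continuous_finsetSum _ fun b _ => continuous_normSq_sum w _ _)]
  have : ∀ a : Fin k, ∫ U, ∑ b : Fin k, Complex.normSq
        (∑ i, w i * (entry U (Fin.castLE h a) i * entry U (Fin.castLE h b) i)) ∂(haarU n) =
      (k + 1) / (n * (n + 1)) * ∑ i, w i ^ 2 := by
    intro a
    rw [integral_finsetSum _ fun b _ => integrable_haarU (continuous_normSq_sum w _ _)]
    simp_rw [integral_normSq_sum]
    -- The factor `k + 1` counts `k` values of `b`, with `b = a` counted twice.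
    rw [← Finset.sum_mul, ← Finset.sum_div, Finset.sum_add_distrib]
    simp
  simp_rw [this]
  rw [Finset.sum_const, Finset.card_univ, Fintype.card_fin, nsmul_eq_mul, ratio]
  simp only [div_eq_mul_inv, mul_inv]
  ring

lemma continuous_trace_compress_frame {k n : ℕ} (h : k ≤ n) (w : Fin n → ℝ) :
    Continuous fun U : Matrix.unitaryGroup (Fin n) ℂ =>
      (compress (frame k U) (Sum.elim w w)).trace := by
  simp_rw [trace_compress_frame h]
  fun_prop

lemma continuous_trace_compress_frame_sq {k n : ℕ} (h : k ≤ n) (w : Fin n → ℝ) :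
    Continuous fun U : Matrix.unitaryGroup (Fin n) ℂ =>
      (compress (frame k U) (Sum.elim w (-w)) ^ 2).trace := by
  simp_rw [trace_compress_frame_sq h]
  exact continuous_const.mul (continuous_finsetSum _ fun a _ =>
    continuous_finsetSum _ fun b _ => continuous_normSq_sum w _ _)

lemma reducedCov_eq (k : ℕ) {n : ℕ} (s : Fin n → ℝ) (U : Matrix.unitaryGroup (Fin n) ℂ) :
    reducedCov k s (U : Matrix (Fin n) (Fin n) ℂ) = compress (frame k U)
      (Sum.elim (fun i => Real.exp (2 * s i)) fun i => Real.exp (-(2 * s i))) := by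
  rw [reducedCov, evolvedCov, initialCov, compress, frame, Matrix.fromBlocks_diagonal,
    Matrix.transpose_mul]
  simp only [Matrix.mul_assoc]

/-! ### Elementary estimates of hyperbolic functions -/

/-- Averaging the Taylor bounds of `exp` at `y` and `-y` cancels the odd terms and leaves the
constant `5/96 ≤ 1/16`. -/
lemma abs_cosh_sub_le {y : ℝ} (hy : |y| ≤ 1) :
    |Real.cosh y - 1 - y ^ 2 / 2| ≤ y ^ 4 / 16 := by
  have h1 := Real.exp_bound hy (n := 4) (by norm_num)
  have h2 := Real.exp_bound (x := -y) (by rwa [abs_neg]) (n := 4) (by norm_num)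
  have e4 : |y| ^ 4 = y ^ 4 := by rw [← abs_pow, abs_of_nonneg (by positivity)]
  simp only [Finset.sum_range_succ, Finset.sum_range_zero, abs_neg, e4] at h1 h2
  norm_num [Nat.factorial] at h1 h2
  have h4 : 0 ≤ y ^ 4 := by positivity
  rw [Real.cosh_eq]
  rw [abs_le] at *
  constructor <;> nlinarith [h1.1, h1.2, h2.1, h2.2]

lemma abs_sinh_sq_sub_le {y : ℝ} (hy : |y| ≤ 1 / 2) :
    |Real.sinh y ^ 2 - y ^ 2| ≤ y ^ 4 / 2 := by
  have h := abs_cosh_sub_le (y := 2 * y) (by rw [abs_mul, abs_two]; linarith)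
  have hc : Real.cosh (2 * y) = 1 + 2 * Real.sinh y ^ 2 := by
    rw [Real.cosh_two_mul, Real.cosh_sq]; ring
  rw [hc] at h
  have e1 : 1 + 2 * Real.sinh y ^ 2 - 1 - (2 * y) ^ 2 / 2 = 2 * (Real.sinh y ^ 2 - y ^ 2) := by ring
  rw [e1, abs_mul, abs_two] at h
  nlinarith

lemma abs_sinh_le {y m : ℝ} (hy : |y| ≤ m) : |Real.sinh y| ≤ Real.sinh m := by
  rw [Real.abs_sinh]
  exact Real.sinh_le_sinh.2 hy

/-! ### Estimates of the entropy of a single state -/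

variable {k n : ℕ}

lemma abs_exp_sub_cosh_le {y x : ℝ} (hy : |y| ≤ x) :
    |Real.exp y - Real.cosh x| ≤ Real.sinh x := by
  have h := abs_le.1 hy
  have h1 : Real.exp y ≤ Real.exp x := Real.exp_le_exp.2 h.2
  have h2 : Real.exp (-x) ≤ Real.exp y := Real.exp_le_exp.2 h.1
  rw [← Real.cosh_add_sinh x] at h1
  rw [← Real.cosh_sub_sinh] at h2
  rw [abs_le]
  constructor <;> linarith

section Norm

open scoped Matrix.Norms.L2Operator

/-- The interval `[e^{-2m}, e^{2m}]` has centre `cosh 2m` and radius `sinh 2m`. Subtracting the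
centre lets a single norm bound confine the eigenvalues from both sides. -/
lemma det_reducedCov_pos_and_abs_S₂_le (h : k ≤ n) {s : Fin n → ℝ} {m : ℝ} (hm : 0 ≤ m)
    (hs : ∀ i, |s i| ≤ m) (U : Matrix.unitaryGroup (Fin n) ℂ) :
    0 < (reducedCov k s (U : Matrix (Fin n) (Fin n) ℂ)).det ∧ |S₂ k s U| ≤ 2 * k * m := by
  have hV := frame_mul_transpose h U
  set f : Fin n ⊕ Fin n → ℝ :=
    Sum.elim (fun i => Real.exp (2 * s i)) fun i => Real.exp (-(2 * s i)) with hf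
  set g : Fin n ⊕ Fin n → ℝ := fun p => f p - Real.cosh (2 * m) with hg
  have hfg : f = g + fun _ => Real.cosh (2 * m) := by
    ext p
    simp [hg]
  have hx : ∀ i, |2 * s i| ≤ 2 * m := fun i => by
    rw [abs_mul, abs_two]
    linarith [hs i]
  have hgn : ∀ p, |g p| ≤ Real.sinh (2 * m) := by
    rintro (i | i)
    · exact abs_exp_sub_cosh_le (hx i)
    · exact abs_exp_sub_cosh_le (by rw [abs_neg]; exact hx i)
  have hsub : compress (frame k U) f - Real.cosh (2 * m) • 1 = compress (frame k U) g := by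
    rw [hfg, compress_add, compress_const hV, add_sub_cancel_right]
  have hsinh : 0 ≤ Real.sinh (2 * m) := Real.sinh_nonneg_iff.2 (by linarith)
  have key := det_pos_and_abs_log_det_le (isHermitian_compress (frame k U) f) (x := 2 * m) (by
    rw [hsub]
    exact norm_compress_le hV hsinh hgn)
  rw [S₂, renyi2, reducedCov_eq]
  refine ⟨key.1, ?_⟩
  have hcard : (Fintype.card (Fin k ⊕ Fin k) : ℝ) = 2 * k := by
    rw [Fintype.card_sum, Fintype.card_fin]
    push_cast
    ring
  rw [hcard] at key
  rw [abs_mul, abs_of_pos (by norm_num : (0 : ℝ) < 1 / 2)]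
  linarith [key.2]

lemma abs_S₂_sub_le (h : k ≤ n) {s : Fin n → ℝ} {m : ℝ} (hm : m ≤ 1 / 16)
    (hm0 : 0 ≤ m) (hs : ∀ i, |s i| ≤ m) (U : Matrix.unitaryGroup (Fin n) ℂ) :
    |S₂ k s U - (1 / 2 * (compress (frame k U) (Sum.elim (fun i => Real.cosh (2 * s i) - 1)
          (fun i => Real.cosh (2 * s i) - 1))).trace -
        1 / 4 * (compress (frame k U) (Sum.elim (fun i => Real.sinh (2 * s i))
          (-fun i => Real.sinh (2 * s i))) ^ 2).trace)| ≤ 10240 * (k * m ^ 4) := by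
  have hV := frame_mul_transpose h U
  set c : Fin n → ℝ := fun i => Real.cosh (2 * s i) - 1 with hc
  set w : Fin n → ℝ := fun i => Real.sinh (2 * s i) with hw
  have hsplit : (Sum.elim (fun i => Real.exp (2 * s i)) fun i => Real.exp (-(2 * s i)) :
      Fin n ⊕ Fin n → ℝ) = (fun _ => 1) + (Sum.elim c c + Sum.elim w (-w)) := by
    ext (i | i)
    · simp only [Sum.elim_inl, Pi.add_apply, hc, hw, ← Real.cosh_add_sinh (2 * s i)]
      ring
    · simp only [Sum.elim_inr, Pi.add_apply, Pi.neg_apply, hc, hw, ← Real.cosh_sub_sinh (2 * s i)]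
      ring
  have hs4 : ∀ i, s i ^ 2 ≤ m ^ 2 := fun i => sq_le_sq' (abs_le.1 (hs i)).1 (abs_le.1 (hs i)).2
  have hs42 : ∀ i, s i ^ 4 ≤ s i ^ 2 := by
    intro i
    have h1 : s i ^ 2 ≤ 1 := (hs4 i).trans (by nlinarith)
    nlinarith [sq_nonneg (s i)]
  have hcn : ∀ i, |c i| ≤ (4 * m) ^ 2 := by
    intro i
    have h1 := abs_cosh_sub_le (y := 2 * s i) (by rw [abs_mul, abs_two]; linarith [hs i])
    have h2 := hs4 i
    have h3 : 0 ≤ s i ^ 2 := sq_nonneg _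
    have h4 : s i ^ 4 ≤ s i ^ 2 := hs42 i
    rw [abs_le] at h1 ⊢
    constructor <;> nlinarith [h1.1, h1.2]
  have hwn : ∀ i, |w i| ≤ 4 * m := by
    intro i
    have h1 := abs_sinh_sq_sub_le (y := 2 * s i) (by rw [abs_mul, abs_two]; linarith [hs i])
    have h2 := hs4 i
    have h3 : 0 ≤ s i ^ 2 := sq_nonneg _
    have h4 : s i ^ 4 ≤ s i ^ 2 := hs42 i
    refine abs_le_of_sq_le_sq ?_ (by linarith)
    have := (abs_le.1 h1).2
    nlinarith
  have hJC := symplecticJ_commute (rowsRe h U) (rowsIm h U) c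
  have hJD := symplecticJ_anticommute (rowsRe h U) (rowsIm h U) w
  rw [← frame_eq h] at hJC hJD
  have key := abs_log_det_sub_le_of_anticommute symplecticJ_transpose_mul_self
    (isHermitian_compress (frame k U) (Sum.elim c c))
    -- `δ = 4m` is a crude common scale: `|sinh 2s| ≤ 4m` and `cosh 2s - 1 ≤ 16m²`. Then `40 δ⁴ =
    -- 10240 m⁴`.
    (isHermitian_compress (frame k U) (Sum.elim w (-w))) hJC hJD (δ := 4 * m) (by linarith)
    (norm_compress_le hV (by positivity) (by rintro (i | i) <;> exact hcn i))
    (norm_compress_le hV (by positivity) (by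
      rintro (i | i)
      · exact hwn i
      · exact (abs_neg _).trans_le (hwn i)))
  have hcov : reducedCov k s (U : Matrix (Fin n) (Fin n) ℂ) =
      1 + (compress (frame k U) (Sum.elim c c) + compress (frame k U) (Sum.elim w (-w))) := by
    rw [reducedCov_eq, hsplit, compress_add, compress_add, compress_const hV, one_smul]
  have hcard : (Fintype.card (Fin k ⊕ Fin k) : ℝ) = 2 * k := by
    rw [Fintype.card_sum, Fintype.card_fin]
    push_cast
    ring
  rw [hcard, ← hcov] at key
  have e : (2 * k : ℝ) * (40 * (4 * m) ^ 4) = 2 * (10240 * (k * m ^ 4)) := by ring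
  rw [e] at key
  rw [S₂, renyi2]
  rw [abs_le] at key ⊢
  constructor <;> linarith [key.1, key.2]

end Norm

/-! ### Haar average of the entropy. -/

lemma abs_le_sMax (s : Fin n → ℝ) (i : Fin n) : |s i| ≤ sMax s :=
  le_ciSup (f := fun i => |s i|) (Set.finite_range _).bddAbove i

lemma sMax_nonneg (s : Fin n → ℝ) : 0 ≤ sMax s :=
  Real.iSup_nonneg fun _ => abs_nonneg _

lemma sMax_le {s : Fin n → ℝ} {m : ℝ} (hm : 0 ≤ m) (hs : ∀ i, |s i| ≤ m) : sMax s ≤ m :=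
  Real.iSup_le hs hm

lemma continuous_S₂ (h : k ≤ n) (s : Fin n → ℝ) : Continuous (S₂ k s) := by
  have hcov : Continuous fun U : Matrix.unitaryGroup (Fin n) ℂ =>
      reducedCov k s (U : Matrix (Fin n) (Fin n) ℂ) := by
    have hU : Continuous fun U : Matrix.unitaryGroup (Fin n) ℂ =>
        (U : Matrix (Fin n) (Fin n) ℂ) := continuous_subtype_val
    have hre := hU.matrix_map Complex.continuous_re
    have him := hU.matrix_map Complex.continuous_im
    have hp : Continuous fun U : Matrix.unitaryGroup (Fin n) ℂ =>
        passive (U : Matrix (Fin n) (Fin n) ℂ) := hre.matrix_fromBlocks him him.neg hre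
    exact (continuous_const.matrix_mul ((hp.matrix_mul continuous_const).matrix_mul
      hp.matrix_transpose)).matrix_mul continuous_const
  refine continuous_const.mul (hcov.matrix_det.log fun U => ?_)
  exact (det_reducedCov_pos_and_abs_S₂_le h (sMax_nonneg s) (abs_le_sMax s) U).1.ne'

lemma abs_pageCurve_le (h : k ≤ n) {s : Fin n → ℝ} {m : ℝ} (hm : 0 ≤ m) (hs : ∀ i, |s i| ≤ m) :
    |pageCurve k s| ≤ 2 * k * m := by
  have := norm_integral_le_of_norm_le_const (μ := haarU n) (f := S₂ k s)
    (Eventually.of_forall fun U => (det_reducedCov_pos_and_abs_S₂_le h hm hs U).2)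
  simpa [pageCurve] using this

/-- The Page curve for weak squeezing, up to terms of fourth order. -/
lemma abs_pageCurve_sub_le (h : k ≤ n) {s : Fin n → ℝ} {m : ℝ} (hm : m ≤ 1 / 16)
    (hm0 : 0 ≤ m) (hs : ∀ i, |s i| ≤ m) :
    |pageCurve k s - (ratio k n * ∑ i, (Real.cosh (2 * s i) - 1) -
        1 / 2 * (ratio k n * ((k + 1) / (n + 1))) * ∑ i, Real.sinh (2 * s i) ^ 2)| ≤
      10240 * (k * m ^ 4) := by
  set c : Fin n → ℝ := fun i => Real.cosh (2 * s i) - 1 with hc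
  set w : Fin n → ℝ := fun i => Real.sinh (2 * s i) with hw
  have hC := (integrable_haarU (continuous_trace_compress_frame h c)).const_mul (1 / 2)
  have hD := (integrable_haarU (continuous_trace_compress_frame_sq h w)).const_mul (1 / 4)
  have hCD : Integrable (fun U => 1 / 2 * (compress (frame k U) (Sum.elim c c)).trace -
      1 / 4 * (compress (frame k U) (Sum.elim w (-w)) ^ 2).trace) (haarU n) := hC.sub hD
  have hbound := norm_integral_le_of_norm_le_const (μ := haarU n)
    (f := fun U => S₂ k s U - (1 / 2 * (compress (frame k U) (Sum.elim c c)).trace -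
      1 / 4 * (compress (frame k U) (Sum.elim w (-w)) ^ 2).trace))
    (Eventually.of_forall (abs_S₂_sub_le h hm hm0 hs))
  rw [integral_sub (integrable_haarU (continuous_S₂ h s)) hCD, integral_sub hC hD,
    integral_const_mul, integral_const_mul, integral_trace_compress_frame h,
    integral_trace_compress_frame_sq h, Real.norm_eq_abs] at hbound
  have e : (haarU n).real Set.univ = 1 := by simp
  rw [e, mul_one] at hbound
  refine le_trans (le_of_eq ?_) hbound
  rw [pageCurve]
  congr 1
  simp only [hw]
  ring

lemma abs_sum_sub_le {f g : Fin n → ℝ} {ε : ℝ} (h : ∀ i, |f i - g i| ≤ ε) :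
    |∑ i, f i - ∑ i, g i| ≤ n * ε := by
  rw [← Finset.sum_sub_distrib]
  calc _ ≤ ∑ i, |f i - g i| := Finset.abs_sum_le_sum_abs _ _
    _ ≤ ∑ _i : Fin n, ε := Finset.sum_le_sum fun i _ => h i
    _ = _ := by simp

lemma ratio_nonneg (k n : ℕ) : 0 ≤ ratio k n := by
  rw [ratio]
  positivity

lemma ratio_le_one (h : k ≤ n) : ratio k n ≤ 1 :=
  div_le_one_of_le₀ (by exact_mod_cast h) (by positivity)

lemma ratio_mul (hn : 1 ≤ n) : ratio k n * n = k := by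
  rw [ratio]
  have : (n : ℝ) ≠ 0 := by exact_mod_cast (by omega : n ≠ 0)
  field_simp

/-- Below `sMax = 1/16` the fourth-order expansion applies; above it both terms on the left are
separately `O(k sMax⁴)`. -/
theorem abs_pageCurve_sub_sum_sq_le (hn : 1 ≤ n) (h : k ≤ n) (s : Fin n → ℝ) :
    |pageCurve k s - 2 * ratio k n * (1 - ratio k n) * ∑ i, s i ^ 2| ≤
      20000 * (ratio k n * n * sMax s ^ 4 + ratio k n * sMax s ^ 2) := by
  set m := sMax s with hmdef
  have hm0 : 0 ≤ m := sMax_nonneg s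
  have hs : ∀ i, |s i| ≤ m := abs_le_sMax s
  have hs2 : ∀ i, s i ^ 2 ≤ m ^ 2 := fun i => sq_le_sq' (abs_le.1 (hs i)).1 (abs_le.1 (hs i)).2
  have hs4 : ∀ i, s i ^ 4 ≤ m ^ 4 := fun i => by nlinarith [hs2 i, sq_nonneg (s i)]
  set r := ratio k n with hr
  have hr0 : 0 ≤ r := ratio_nonneg k n
  have hr1 : r ≤ 1 := ratio_le_one h
  have hrn : r * n = k := ratio_mul hn
  have hn0 : (0 : ℝ) < n := by exact_mod_cast hn
  have hS0 : 0 ≤ ∑ i, s i ^ 2 := Finset.sum_nonneg fun i _ => sq_nonneg _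
  have hS : ∑ i, s i ^ 2 ≤ n * m ^ 2 :=
    (Finset.sum_le_sum fun i _ => hs2 i).trans (by simp)
  rw [hrn]
  have hkm : 0 ≤ k * m ^ 4 := by positivity
  have hrm : 0 ≤ r * m ^ 2 := by positivity
  rcases le_total m (1 / 16) with hm | hm
  · have h1 := abs_pageCurve_sub_le h hm hm0 hs
    have hcosh : |∑ i, (Real.cosh (2 * s i) - 1) - ∑ i, 2 * s i ^ 2| ≤ n * m ^ 4 := by
      refine abs_sum_sub_le fun i => ?_
      have h2 := abs_cosh_sub_le (y := 2 * s i) (by rw [abs_mul, abs_two]; linarith [hs i])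
      have e : (2 * s i) ^ 2 / 2 = 2 * s i ^ 2 := by ring
      have e' : (2 * s i) ^ 4 / 16 = s i ^ 4 := by ring
      rw [e, e'] at h2
      exact h2.trans (hs4 i)
    have hsinh : |∑ i, Real.sinh (2 * s i) ^ 2 - ∑ i, 4 * s i ^ 2| ≤ n * (8 * m ^ 4) := by
      refine abs_sum_sub_le fun i => ?_
      have h2 := abs_sinh_sq_sub_le (y := 2 * s i) (by rw [abs_mul, abs_two]; linarith [hs i])
      have e : (2 * s i) ^ 2 = 4 * s i ^ 2 := by ring
      have e' : (2 * s i) ^ 4 / 2 = 8 * s i ^ 4 := by ring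
      rw [e, e'] at h2
      exact h2.trans (by linarith [hs4 i])
    rw [← Finset.mul_sum] at hcosh hsinh
    set q : ℝ := (k + 1) / (n + 1) with hq
    have hkn : (k : ℝ) ≤ n := by exact_mod_cast h
    have hq0 : 0 ≤ q := by positivity
    have hq1 : q ≤ 1 := div_le_one_of_le₀ (by linarith) (by positivity)
    -- This discrepancy is the only source of the error `r * m ^ 2`.
    have hqr : |r - q| ≤ 1 / n := by
      have e : r - q = -((n - k) / (n * (n + 1))) := by
        rw [hr, hq, ratio]
        field_simp
        ring
      rw [e, abs_neg, abs_of_nonneg (div_nonneg (by linarith) (by positivity)),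
        div_le_div_iff₀ (by positivity) hn0]
      nlinarith [Nat.cast_nonneg (α := ℝ) k]
    set A := ∑ i, (Real.cosh (2 * s i) - 1)
    set B := ∑ i, Real.sinh (2 * s i) ^ 2
    set S := ∑ i, s i ^ 2
    have t1 : |r * (A - 2 * S)| ≤ k * m ^ 4 := by
      rw [abs_mul, abs_of_nonneg hr0, ← hrn, mul_assoc]
      gcongr
    have t2 : |1 / 2 * (r * q) * (B - 4 * S)| ≤ 4 * (k * m ^ 4) := by
      rw [abs_mul, abs_of_nonneg (by positivity)]
      calc 1 / 2 * (r * q) * |B - 4 * S| ≤ 1 / 2 * (r * 1) * (n * (8 * m ^ 4)) := by gcongr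
        _ = 4 * (k * m ^ 4) := by rw [← hrn]; ring
    have t3 : |2 * r * (r - q) * S| ≤ 2 * (r * m ^ 2) := by
      rw [abs_mul, abs_mul, abs_of_nonneg (by positivity : 0 ≤ 2 * r), abs_of_nonneg hS0]
      calc 2 * r * |r - q| * S ≤ 2 * r * (1 / n) * (n * m ^ 2) := by gcongr
        _ = 2 * (r * m ^ 2) := by field_simp
    have e : pageCurve k s - 2 * r * (1 - r) * S =
        (pageCurve k s - (r * A - 1 / 2 * (r * q) * B)) + r * (A - 2 * S) -
          1 / 2 * (r * q) * (B - 4 * S) + 2 * r * (r - q) * S := by ring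
    rw [e]
    rw [abs_le] at h1 t1 t2 t3 ⊢
    constructor <;> linarith [h1.1, h1.2, t1.1, t1.2, t2.1, t2.2, t3.1, t3.2]
  · have h1 := abs_pageCurve_le h hm0 hs
    have h2 : |2 * r * (1 - r) * ∑ i, s i ^ 2| ≤ 2 * (k * m ^ 2) := by
      rw [abs_of_nonneg (by have := sub_nonneg.2 hr1; positivity)]
      calc 2 * r * (1 - r) * ∑ i, s i ^ 2 ≤ 2 * r * 1 * (n * m ^ 2) := by
            gcongr
            linarith
        _ = 2 * (k * m ^ 2) := by rw [← hrn]; ring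
    have hm2 : (1 / 16) ^ 2 ≤ m ^ 2 := by gcongr
    have hm3 : (1 / 16) ^ 3 ≤ m ^ 3 := by gcongr
    -- `4096 = 16³`, and `256 = 16²` below; the total `2 * 4096 + 2 * 256` is below `20000`.
    have h3 : k * m ≤ 4096 * (k * m ^ 4) := by
      have : m ≤ 4096 * m ^ 4 := by nlinarith
      nlinarith [Nat.cast_nonneg (α := ℝ) k]
    have h4 : k * m ^ 2 ≤ 256 * (k * m ^ 4) := by
      have : m ^ 2 ≤ 256 * m ^ 4 := by nlinarith
      nlinarith [Nat.cast_nonneg (α := ℝ) k]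
    refine (abs_sub _ _).trans ?_
    linarith

/-! ### Special regimes and the boson number. -/

/-- This also covers small `n`, where `K / √n` need not be small: for `|y| ≥ 1/2` one has `y⁴ ≥
1/16`, which absorbs both squares. -/
lemma sinh_sq_sub_sq_le {y : ℝ} {K : ℝ} (hy : |y| ≤ K) :
    |Real.sinh y ^ 2 - y ^ 2| ≤ (16 + 16 * Real.sinh K ^ 2) * y ^ 4 := by
  have hy4 : 0 ≤ y ^ 4 := by positivity
  have hK0 : 0 ≤ Real.sinh K ^ 2 := sq_nonneg _
  rcases le_total |y| (1 / 2) with h | h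
  · exact (abs_sinh_sq_sub_le h).trans (by nlinarith)
  · have h1 : Real.sinh y ^ 2 ≤ Real.sinh K ^ 2 := by
      rw [← sq_abs (Real.sinh y)]
      exact pow_le_pow_left₀ (abs_nonneg _) (abs_sinh_le hy) 2
    have h2 : 1 / 4 ≤ y ^ 2 := by
      rw [← sq_abs y]
      nlinarith
    have h3 : 1 / 16 ≤ y ^ 4 := by nlinarith
    have h4 : y ^ 2 ≤ 4 * y ^ 4 := by nlinarith
    have h5 : 0 ≤ Real.sinh y ^ 2 := sq_nonneg _
    have h6 : Real.sinh K ^ 2 ≤ 16 * Real.sinh K ^ 2 * y ^ 4 := by nlinarith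
    rw [abs_le]
    constructor <;> nlinarith

/-- The lower bound on `n * sMax s ^ 2` absorbs the second-order error into the fourth-order one. -/
lemma abs_pageCurve_sub_le_of_le_mul_sMax_sq {c : ℝ} (hc : 0 < c) (hn : 1 ≤ n) (h : k ≤ n)
    {s : Fin n → ℝ} (hs : c ≤ n * sMax s ^ 2) :
    |pageCurve k s - 2 * ratio k n * (1 - ratio k n) * ∑ i, s i ^ 2| ≤
      20000 * (1 + 1 / c) * (ratio k n * n * sMax s ^ 4) := by
  refine (abs_pageCurve_sub_sum_sq_le hn h s).trans ?_
  have h1 : sMax s ^ 2 ≤ 1 / c * (n * sMax s ^ 4) := by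
    rw [div_mul_eq_mul_div, one_mul, le_div_iff₀ hc]
    nlinarith [sq_nonneg (sMax s)]
  have h2 := mul_le_mul_of_nonneg_left h1 (ratio_nonneg k n)
  linarith

lemma totalBosons_sub_le {s : Fin n → ℝ} {K : ℝ} (hK : 0 ≤ K) (hn : 1 ≤ n)
    (hs : ∀ i, |s i| ≤ K / Real.sqrt n) :
    |totalBosons s - ∑ i, s i ^ 2| ≤ (16 + 16 * Real.sinh K ^ 2) * K ^ 4 / n ∧
      ∑ i, s i ^ 2 ≤ K ^ 2 := by
  have hn1 : (1 : ℝ) ≤ n := by exact_mod_cast hn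
  have hn0 : (0 : ℝ) < n := by linarith
  have hsK : ∀ i, |s i| ≤ K := fun i =>
    (hs i).trans (div_le_self hK (Real.one_le_sqrt.2 hn1))
  have h2 : ∀ i, s i ^ 2 ≤ K ^ 2 / n := by
    intro i
    rw [← sq_abs]
    calc |s i| ^ 2 ≤ (K / Real.sqrt n) ^ 2 := pow_le_pow_left₀ (abs_nonneg _) (hs i) 2
      _ = K ^ 2 / n := by rw [div_pow, Real.sq_sqrt hn0.le]
  have h4 : ∀ i, s i ^ 4 ≤ K ^ 4 / n ^ 2 := by
    intro i
    calc s i ^ 4 = (s i ^ 2) ^ 2 := by ring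
      _ ≤ (K ^ 2 / n) ^ 2 := pow_le_pow_left₀ (sq_nonneg _) (h2 i) 2
      _ = K ^ 4 / n ^ 2 := by rw [div_pow]; ring
  constructor
  · have h := abs_sum_sub_le (f := fun i => Real.sinh (s i) ^ 2) (g := fun i => s i ^ 2)
      (ε := (16 + 16 * Real.sinh K ^ 2) * (K ^ 4 / n ^ 2)) fun i =>
        (sinh_sq_sub_sq_le (hsK i)).trans (by
          have := h4 i
          gcongr)
    refine h.trans (le_of_eq ?_)
    field_simp
  · calc ∑ i, s i ^ 2 ≤ ∑ _i : Fin n, K ^ 2 / n := Finset.sum_le_sum fun i _ => h2 i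
      _ = K ^ 2 := by
        rw [Finset.sum_const, Finset.card_univ, Fintype.card_fin, nsmul_eq_mul]
        field_simp

/-- With `sMax² ≤ K² / n` both general error terms are `O(r / n)`, and so is the cost of replacing
`∑ sᵢ²` by the boson number. -/
lemma abs_pageCurve_sub_totalBosons_le {s : Fin n → ℝ} {K : ℝ} (hK : 0 ≤ K) (hn : 1 ≤ n)
    (h : k ≤ n) (hs : ∀ i, |s i| ≤ K / Real.sqrt n) :
    |pageCurve k s - 2 * ratio k n * (1 - ratio k n) * totalBosons s| ≤
      (20000 * (K ^ 4 + K ^ 2) + 2 * ((16 + 16 * Real.sinh K ^ 2) * K ^ 4)) * (ratio k n / n) := by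
  have hn0 : (0 : ℝ) < n := by exact_mod_cast hn
  have h1 := abs_pageCurve_sub_sum_sq_le hn h s
  have h2 := (totalBosons_sub_le hK hn hs).1
  have hr0 := ratio_nonneg k n
  have hr1 := ratio_le_one h
  set r := ratio k n
  have hm : sMax s ≤ K / Real.sqrt n := sMax_le (by positivity) hs
  have hm2 : sMax s ^ 2 ≤ K ^ 2 / n := by
    calc sMax s ^ 2 ≤ (K / Real.sqrt n) ^ 2 := pow_le_pow_left₀ (sMax_nonneg s) hm 2
      _ = K ^ 2 / n := by rw [div_pow, Real.sq_sqrt hn0.le]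
  have hm4 : sMax s ^ 4 ≤ K ^ 4 / n ^ 2 := by
    calc sMax s ^ 4 = (sMax s ^ 2) ^ 2 := by ring
      _ ≤ (K ^ 2 / n) ^ 2 := pow_le_pow_left₀ (sq_nonneg _) hm2 2
      _ = K ^ 4 / n ^ 2 := by rw [div_pow]; ring
  have h3 : r * n * sMax s ^ 4 + r * sMax s ^ 2 ≤ (K ^ 4 + K ^ 2) * (r / n) := by
    calc _ ≤ r * n * (K ^ 4 / n ^ 2) + r * (K ^ 2 / n) := by gcongr
      _ = _ := by field_simp
  have h4 : |2 * r * (1 - r) * (totalBosons s - ∑ i, s i ^ 2)| ≤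
      2 * ((16 + 16 * Real.sinh K ^ 2) * K ^ 4) * (r / n) := by
    have hr : |2 * r * (1 - r)| ≤ 2 * r := by
      rw [abs_of_nonneg (by have := sub_nonneg.2 hr1; positivity)]
      nlinarith
    rw [abs_mul]
    calc _ ≤ 2 * r * ((16 + 16 * Real.sinh K ^ 2) * K ^ 4 / n) := by gcongr
      _ = _ := by ring
  have e : pageCurve k s - 2 * r * (1 - r) * totalBosons s =
      (pageCurve k s - 2 * r * (1 - r) * ∑ i, s i ^ 2) -
        2 * r * (1 - r) * (totalBosons s - ∑ i, s i ^ 2) := by ring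
  rw [e]
  refine (abs_sub _ _).trans ?_
  linarith

end LinearOptics

end

theorem mainTheorem8 :
    -- the expectations below are those of integrable functions
    (∀ (n k : ℕ) (s : Fin n → ℝ), k ≤ n →
      Integrable (LinearOptics.S₂ k s) (LinearOptics.haarU n)) ∧
    -- fixed squeezings `s 0, s 1, …`, as `n → ∞`, with an absolute constant
    (∃ C : ℝ, 0 < C ∧ ∀ s : ℕ → ℝ, ∀ᶠ n : ℕ in atTop, ∀ k : ℕ, k ≤ n →
      |LinearOptics.pageCurve k (fun i : Fin n => s i) -
          2 * LinearOptics.ratio k n * (1 - LinearOptics.ratio k n) *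
            ∑ i : Fin n, s i ^ 2| ≤
        C * (LinearOptics.ratio k n * n *
          LinearOptics.sMax (fun i : Fin n => s i) ^ 4)) ∧
    -- squeezings that may depend on `n`, with `n * sMax ^ 2` bounded below
    (∀ c : ℝ, 0 < c → ∃ C : ℝ, 0 < C ∧
      ∀ (n k : ℕ) (s : Fin n → ℝ), 1 ≤ n → k ≤ n → c ≤ n * LinearOptics.sMax s ^ 2 →
        |LinearOptics.pageCurve k s -
            2 * LinearOptics.ratio k n * (1 - LinearOptics.ratio k n) * ∑ i, s i ^ 2| ≤
          C * (LinearOptics.ratio k n * n * LinearOptics.sMax s ^ 4)) ∧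
    -- arbitrary squeezings that may depend on `n`
    (∃ C : ℝ, 0 < C ∧
      ∀ (n k : ℕ) (s : Fin n → ℝ), 1 ≤ n → k ≤ n →
        |LinearOptics.pageCurve k s -
            2 * LinearOptics.ratio k n * (1 - LinearOptics.ratio k n) * ∑ i, s i ^ 2| ≤
          C * (LinearOptics.ratio k n * n * LinearOptics.sMax s ^ 4 +
            LinearOptics.ratio k n * LinearOptics.sMax s ^ 2)) ∧
    -- squeezings of order `1 / √n`: the total boson number is `O(1)`
    (∀ K : ℝ, 0 < K → ∃ C : ℝ, 0 < C ∧
      ∀ (n k : ℕ) (s : Fin n → ℝ), 1 ≤ n → k ≤ n → (∀ i, |s i| ≤ K / Real.sqrt n) →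
        LinearOptics.totalBosons s ≤ C ∧
        |LinearOptics.pageCurve k s -
            2 * LinearOptics.ratio k n * (1 - LinearOptics.ratio k n) *
              LinearOptics.totalBosons s| ≤
          C * (LinearOptics.ratio k n / n)) := by
  refine ⟨fun n k s h => LinearOptics.integrable_haarU (LinearOptics.continuous_S₂ h s),
    ⟨20000 * (1 + 1 / 1), by norm_num, fun s => ?_⟩,
    fun c hc => ⟨20000 * (1 + 1 / c), by positivity, fun n k s hn h hs =>
      LinearOptics.abs_pageCurve_sub_le_of_le_mul_sMax_sq hc hn h hs⟩,
    ⟨20000, by norm_num, fun n k s hn h => LinearOptics.abs_pageCurve_sub_sum_sq_le hn h s⟩,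
    fun K hK => ?_⟩
  -- The zero sequence never satisfies `1 ≤ n * sMax²`, but there the general error bound vanishes.
  -- Otherwise any `s j ≠ 0` forces `n * sMax² → ∞`, and `c = 1` is eventually admissible.
  · by_cases hs : ∀ i, s i = 0
    · filter_upwards [eventually_ge_atTop 1] with n hn k h
      have hmax : LinearOptics.sMax (fun i : Fin n => s i) = 0 :=
        le_antisymm (LinearOptics.sMax_le le_rfl fun i => by simp [hs]) (LinearOptics.sMax_nonneg _)
      have := LinearOptics.abs_pageCurve_sub_sum_sq_le hn h (fun i : Fin n => s i)
      rw [hmax] at this ⊢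
      simpa using this
    · obtain ⟨j, hj⟩ := not_forall.1 hs
      have hlim : Tendsto (fun n : ℕ => (n : ℝ) * |s j| ^ 2) atTop atTop :=
        tendsto_natCast_atTop_atTop.atTop_mul_const (by positivity)
      filter_upwards [eventually_gt_atTop j, hlim.eventually_ge_atTop 1] with n hn hn1 k h
      refine LinearOptics.abs_pageCurve_sub_le_of_le_mul_sMax_sq one_pos (by omega) h
        (hn1.trans ?_)
      have := LinearOptics.abs_le_sMax (fun i : Fin n => s i) ⟨j, hn⟩
      gcongr
  · set M : ℝ := (16 + 16 * Real.sinh K ^ 2) * K ^ 4 with hM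
    have hM0 : 0 ≤ M := by positivity
    -- The constant for the entropy also exceeds `K ^ 2 + M`, which bounds the boson number.
    refine ⟨20000 * (K ^ 4 + K ^ 2) + 2 * M, by positivity, fun n k s hn h hs => ⟨?_, ?_⟩⟩
    · obtain ⟨h1, h2⟩ := LinearOptics.totalBosons_sub_le hK.le hn hs
      have h3 : M / n ≤ M := div_le_self hM0 (by exact_mod_cast hn)
      have h4 := (abs_le.1 h1).2
      have h5 : 0 ≤ K ^ 4 := by positivity
      have h6 : 0 ≤ K ^ 2 := by positivity
      linarith
    · exact LinearOptics.abs_pageCurve_sub_totalBosons_le hK.le hn h hs
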